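/- Throughout, $A,A',B,B',C,C',C''$ are complex $N\times N$ matrices, $I$ is the identity matrix, $r\ge 0$ is an integer and $x,y$ are complex variables. For an integer $n\ge 0$ put $(A)_n=A(A+I)\cdots(A+(n-1)I)$ (with $(A)_0=I$), $(A)_n^{-1}=((A)_n)^{-1}$, and, for $n\ge1$, $(A)_{-n}=(-1)^n(I-A)_n^{-1}$. For $z\in\mathbb{C}\setminus(-\infty,0]$ and a matrix $P$ let $z^P=\exp(P\log z)$ with the principal logarithm; $\partial_x,\partial_y$ are the partial derivatives. A coefficient family $c_{m,n}$ defines the matrix function $F(x,y)=\sum_{m,n\ge0}c_{m,n}\frac{x^my^n}{m!\,n!}$. The Horn matrix functions and their confluent forms $F$ are given by the following $c_{m,n}$: - $G_{2}(A,A',B,B';x,y)$: $c_{m,n}=(A)_{m}(A')_{n}(B)_{n-m}(B')_{m-n}$ - $G_{3}(A,A';x,y)$: $c_{m,n}=(A)_{2n-m}(A')_{2m-n}$ - $H_{1}(A,B,C,C';x,y)$: $c_{m,n}=(A)_{m-n}(B)_{m+n}(C)_{n}(C')_{m}^{-1}$ - $H_{2}(A,B,C,C',C'';x,y)$: $c_{m,n}=(A)_{m-n}(B)_{m}(C)_{n}(C')_{n}(C'')_{m}^{-1}$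 - $H_{3}(A,B,C;x,y)$: $c_{m,n}=(A)_{2m+n}(B)_{n}(C)_{m+n}^{-1}$ - $H_{4}(A,B,C,C';x,y)$: $c_{m,n}=(A)_{2m+n}(B)_{n}(C)_{m}^{-1}(C')_{n}^{-1}$ - $H_{5}(A,B,C;x,y)$: $c_{m,n}=(A)_{2m+n}(B)_{n-m}(C)_{n}^{-1}$ - $H_{6}(A,B,C;x,y)$: $c_{m,n}=(A)_{2m-n}(B)_{n-m}(C)_{n}$ - $H_{7}(A,B,C,C';x,y)$: $c_{m,n}=(A)_{2m-n}(B)_{n}(C)_{n}(C')_{m}^{-1}$ - $\Gamma_{1}(A,B,B';x,y)$: $c_{m,n}=(A)_{m}(B)_{n-m}(B')_{m-n}$ - $\Gamma_{2}(B,B';x,y)$: $c_{m,n}=(B)_{n-m}(B')_{m-n}$ - $\mathcal{H}_{1}(A,B,C;x,y)$: $c_{m,n}=(A)_{m-n}(B)_{m+n}(C)_{m}^{-1}$ - $\mathcal{H}_{2}(A,B,B',C;x,y)$: $c_{m,n}=(A)_{m-n}(B)_{m}(B')_{n}(C)_{m}^{-1}$ - $\mathcal{H}_{3}(A,B,C;x,y)$: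 $c_{m,n}=(A)_{m-n}(B)_{m}(C)_{m}^{-1}$ - $\mathcal{H}_{4}(A,B',C;x,y)$: $c_{m,n}=(A)_{m-n}(B')_{n}(C)_{m}^{-1}$ - $\mathcal{H}_{5}(A,C;x,y)$: $c_{m,n}=(A)_{m-n}(C)_{m}^{-1}$ - $\mathcal{H}_{6}(A,C;x,y)$: $c_{m,n}=(A)_{2m+n}(C)_{m+n}^{-1}$ - $\mathcal{H}_{7}(A,C,C';x,y)$: $c_{m,n}=(A)_{2m+n}(C)_{m}^{-1}(C')_{n}^{-1}$ - $\mathcal{H}_{8}(A,B;x,y)$: $c_{m,n}=(A)_{2m-n}(B)_{n-m}$ - $\mathcal{H}_{9}(A,B,C;x,y)$: $c_{m,n}=(A)_{2m-n}(B)_{n}(C)_{m}^{-1}$ - $\mathcal{H}_{10}(A,C;x,y)$: $c_{m,n}=(A)_{2m-n}(C)_{m}^{-1}$ - $\mathcal{H}_{11}(A,B,C,C';x,y)$: $c_{m,n}=(A)_{m-n}(B)_{n}(C)_{n}(C')_{m}^{-1}$ $F[P+rI,\dots]$ denotes $F$ with the parameter $P$ replaced by $P+rI$, and so on, the other parameters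 being unchanged. Such a function is said to be defined at a point $(x,y)$ if its coefficients are defined (that is, $P+kI$ is invertible for all integers $k\ge0$ for each $P$ that occurs as $(P)^{-1}_{\,\cdot}$, and $P-kI$ is invertible for all integers $k\ge1$ for each $P$ that occurs with an index containing a difference such as $m-n$, $n-m$, $2m-n$, $2n-m$), and $(x,y)$ lies in the region of absolute convergence, the interior of the set of points at which the double series converges absolutely. Then each formula below holds under the commutativity hypotheses listed with it (none if none are listed), at every point at which the two functions $F[\dots]$ on its two sides are defined and, if a matrix power $x^P$ or $y^P$ occurs, its base is in $\mathbb{C}\setminus(-\infty,0]$; moreover the function that is differentiated is analytic in the variable of differentiation there. **$G_{2}$:** 1. $\partial_x^r G_{2}(x, y)=(-1)^r\,(A)_r\,G_{2}[A+rI, B-rI, B'+rI](x, y)\,(I-B)_r^{-1}\,(B')_r$ if $BB'=B'B$ 2. $\partial_y^r G_{2}(x, y)=(-1)^r\,(A')_r\,G_{2}[A'+rI, B+rI, B'-rI](x, y)\,(B)_r\,(I-B')_r^{-1}$ if $AA'=A'A$, $BB'=B'B$ 3. $(x^2\partial_x)^r [x^{A}\,G_{2}(x, y)]=x^{A+rI}\,(A)_r\,G_{2}[A+rI](x,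 y)$ 4. $(y^2\partial_y)^r [y^{A'}\,G_{2}(x, y)]=y^{A'+rI}\,(A')_r\,G_{2}[A'+rI](x, y)$ if $AA'=A'A$ 5. $(x^2\partial_x)^r [G_{2}(x, y/x)\,x^{B'}]=G_{2}[B'+rI](x, y/x)\,x^{B'+rI}\,(B')_r$ 6. $(y^2\partial_y)^r [G_{2}(x/y, y)\,y^{B}]=G_{2}[B+rI](x/y, y)\,y^{B+rI}\,(B)_r$ if $BB'=B'B$ **$G_{3}$:** 1. $\partial_x^r G_{3}(x, y)=(-1)^r\,(I-A)_r^{-1}\,G_{3}[A-rI, A'+2rI](x, y)\,(A')_{2r}$ 2. $\partial_y^r G_{3}(x, y)=(-1)^r\,(A)_{2r}\,G_{3}[A+2rI, A'-rI](x, y)\,(I-A')_r^{-1}$ 3. $(x^2\partial_x)^r [G_{3}(x^2, y/x)\,x^{A'}]=G_{3}[A'+rI](x^2, y/x)\,x^{A'+rI}\,(A')_r$ 4. $(y^2\partial_y)^r [y^{A}\,G_{3}(x/y, y^2)]=y^{A+rI}\,(A)_r\,G_{3}[A+rI](x/y, y^2)$ **$H_{1}$:** 1. $\partial_x^r H_{1}(x,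 y)=(A)_r\,(B)_r\,H_{1}[A+rI, B+rI, C'+rI](x, y)\,(C')_r^{-1}$ if $AB=BA$ 2. $\partial_y^r H_{1}(x, y)=(-1)^r\,(I-A)_r^{-1}\,(B)_r\,H_{1}[A-rI, B+rI, C+rI](x, y)\,(C)_r$ if $AB=BA$, $CC'=C'C$ 3. $(x^2\partial_x)^r [x^{A}\,H_{1}(x, y/x)]=x^{A+rI}\,(A)_r\,H_{1}[A+rI](x, y/x)$ 4. $(x^2\partial_x)^r [x^{B}\,H_{1}(x, xy)]=x^{B+rI}\,(B)_r\,H_{1}[B+rI](x, xy)$ if $AB=BA$ 5. $(y^2\partial_y)^r [H_{1}(x, y)\,y^{C}]=H_{1}[C+rI](x, y)\,y^{C+rI}\,(C)_r$ if $CC'=C'C$ 6. $\partial_x^r [H_{1}(x, y)\,x^{C'-I}]=(-1)^r\,H_{1}[C'-rI](x, y)\,(I-C')_r\,x^{C'-(r+1)I}$ **$H_{2}$:** 1. $\partial_x^r H_{2}(x, y)=(A)_r\,(B)_r\,H_{2}[A+rI, B+rI, C''+rI](x, y)\,(C'')_r^{-1}$ if $AB=BA$ 2. $\partial_y^r H_{2}(x,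 y)=(-1)^r\,(I-A)_r^{-1}\,H_{2}[A-rI, C+rI, C'+rI](x, y)\,(C)_r\,(C')_r$ if $CC'=C'C$, $CC''=C''C$, $C'C''=C''C'$ 3. $(x^2\partial_x)^r [x^{A}\,H_{2}(x, y/x)]=x^{A+rI}\,(A)_r\,H_{2}[A+rI](x, y/x)$ 4. $(x^2\partial_x)^r [x^{B}\,H_{2}(x, y)]=x^{B+rI}\,(B)_r\,H_{2}[B+rI](x, y)$ if $AB=BA$ 5. $(y^2\partial_y)^r [H_{2}(x, y)\,y^{C}]=H_{2}[C+rI](x, y)\,y^{C+rI}\,(C)_r$ if $CC'=C'C$, $CC''=C''C$ 6. $\partial_x^r [H_{2}(x, y)\,x^{C''-I}]=(-1)^r\,H_{2}[C''-rI](x, y)\,(I-C'')_r\,x^{C''-(r+1)I}$ **$H_{3}$:** 1. $\partial_x^r H_{3}(x, y)=(A)_{2r}\,H_{3}[A+2rI, C+rI](x, y)\,(C)_r^{-1}$ 2. $\partial_y^r H_{3}(x, y)=(A)_r\,H_{3}[A+rI, B+rI, C+rI](x, y)\,(B)_r\,(C)_r^{-1}$ if $BC=CB$ 3. $(x^2\partial_x)^r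 [x^{A}\,H_{3}(x^2, xy)]=x^{A+rI}\,(A)_r\,H_{3}[A+rI](x^2, xy)$ 4. $(y^2\partial_y)^r [H_{3}(x, y)\,y^{B}]=H_{3}[B+rI](x, y)\,y^{B+rI}\,(B)_r$ if $BC=CB$ 5. $\partial_x^r [H_{3}(x, xy)\,x^{C-I}]=(-1)^r\,H_{3}[C-rI](x, xy)\,x^{C-(r+1)I}\,(I-C)_r$ **$H_{4}$:** 1. $\partial_x^r H_{4}(x, y)=(A)_{2r}\,H_{4}[A+2rI, C+rI](x, y)\,(C)_r^{-1}$ if $CC'=C'C$ 2. $\partial_y^r H_{4}(x, y)=(A)_r\,(B)_r\,H_{4}[A+rI, B+rI, C'+rI](x, y)\,(C')_r^{-1}$ if $AB=BA$ 3. $(x^2\partial_x)^r [x^{A}\,H_{4}(x^2, xy)]=x^{A+rI}\,(A)_r\,H_{4}[A+rI](x^2, xy)$ 4. $(y^2\partial_y)^r [y^{B}\,H_{4}(x, y)]=y^{B+rI}\,(B)_r\,H_{4}[B+rI](x, y)$ if $AB=BA$ 5. $\partial_x^r [H_{4}(x, y)\,x^{C-I}]=(-1)^r\,H_{4}[C-rI](x,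 y)\,x^{C-(r+1)I}\,(I-C)_r$ if $CC'=C'C$ 6. $\partial_y^r [H_{4}(x, y)\,y^{C'-I}]=(-1)^r\,H_{4}[C'-rI](x, y)\,y^{C'-(r+1)I}\,(I-C')_r$ **$H_{5}$:** 1. $\partial_x^r H_{5}(x, y)=(-1)^r\,(A)_{2r}\,(I-B)_r^{-1}\,H_{5}[A+2rI, B-rI](x, y)$ if $AB=BA$ 2. $\partial_y^r H_{5}(x, y)=(A)_r\,(B)_r\,H_{5}[A+rI, B+rI, C+rI](x, y)\,(C)_r^{-1}$ if $AB=BA$ 3. $(x^2\partial_x)^r [x^{A}\,H_{5}(x^2, xy)]=x^{A+rI}\,(A)_r\,H_{5}[A+rI](x^2, xy)$ 4. $(y^2\partial_y)^r [y^{B}\,H_{5}(x/y, y)]=y^{B+rI}\,(B)_r\,H_{5}[B+rI](x/y, y)$ if $AB=BA$ 5. $\partial_y^r [H_{5}(x, y)\,y^{C-I}]=(-1)^r\,H_{5}[C-rI](x, y)\,y^{C-(r+1)I}\,(I-C)_r$ **$H_{6}$:** 1. $\partial_x^r H_{6}(x, y)=(-1)^r\,(A)_{2r}\,(I-B)_r^{-1}\,H_{6}[A+2rI,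 B-rI](x, y)$ if $AB=BA$ 2. $\partial_y^r H_{6}(x, y)=(-1)^r\,(I-A)_r^{-1}\,(B)_r\,H_{6}[A-rI, B+rI, C+rI](x, y)\,(C)_r$ if $AB=BA$ 3. $(x^2\partial_x)^r [x^{A}\,H_{6}(x^2, y/x)]=x^{A+rI}\,(A)_r\,H_{6}[A+rI](x^2, y/x)$ 4. $(y^2\partial_y)^r [y^{B}\,H_{6}(x/y, y)]=y^{B+rI}\,(B)_r\,H_{6}[B+rI](x/y, y)$ if $AB=BA$ 5. $(y^2\partial_y)^r [H_{6}(x, y)\,y^{C}]=H_{6}[C+rI](x, y)\,y^{C+rI}\,(C)_r$ **$H_{7}$:** 1. $\partial_x^r H_{7}(x, y)=(A)_{2r}\,H_{7}[A+2rI, C'+rI](x, y)\,(C')_r^{-1}$ 2. $\partial_y^r H_{7}(x, y)=(-1)^r\,(I-A)_r^{-1}\,(B)_r\,H_{7}[A-rI, B+rI, C+rI](x, y)\,(C)_r$ if $AB=BA$, $CC'=C'C$ 3. $(x^2\partial_x)^r [x^{A}\,H_{7}(x^2, y/x)]=x^{A+rI}\,(A)_r\,H_{7}[A+rI](x^2,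 y/x)$ 4. $(y^2\partial_y)^r [y^{B}\,H_{7}(x, y)]=y^{B+rI}\,(B)_r\,H_{7}[B+rI](x, y)$ if $AB=BA$ 5. $(y^2\partial_y)^r [H_{7}(x, y)\,y^{C}]=H_{7}[C+rI](x, y)\,y^{C+rI}\,(C)_r$ if $CC'=C'C$ 6. $\partial_x^r [H_{7}(x, y)\,x^{C'-I}]=(-1)^r\,H_{7}[C'-rI](x, y)\,x^{C'-(r+1)I}\,(I-C')_r$ **$\Gamma_{1}$:** 1. $\partial_x^r \Gamma_{1}(x, y)=(-1)^r\,(A)_r\,\Gamma_{1}[A+rI, B-rI, B'+rI](x, y)\,(I-B)_r^{-1}\,(B')_r$ if $BB'=B'B$ 2. $\partial_y^r \Gamma_{1}(x, y)=(-1)^r\,\Gamma_{1}[B+rI, B'-rI](x, y)\,(B)_r\,(I-B')_r^{-1}$ if $BB'=B'B$ 3. $(x^2\partial_x)^r [x^{A}\,\Gamma_{1}(x, y)]=x^{A+rI}\,(A)_r\,\Gamma_{1}[A+rI](x, y)$ 4. $(x^2\partial_x)^r [\Gamma_{1}(x, y/x)\,x^{B'}]=\Gamma_{1}[B'+rI](x,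 y/x)\,x^{B'+rI}\,(B')_r$ 5. $(y^2\partial_y)^r [\Gamma_{1}(x/y, y)\,y^{B}]=\Gamma_{1}[B+rI](x/y, y)\,y^{B+rI}\,(B)_r$ if $BB'=B'B$ **$\Gamma_{2}$:** 1. $\partial_x^r \Gamma_{2}(x, y)=(-1)^r\,(I-B)_r^{-1}\,\Gamma_{2}[B-rI, B'+rI](x, y)\,(B')_r$ 2. $\partial_y^r \Gamma_{2}(x, y)=(-1)^r\,(B)_r\,\Gamma_{2}[B+rI, B'-rI](x, y)\,(I-B')_r^{-1}$ 3. $(x^2\partial_x)^r [\Gamma_{2}(x, y/x)\,x^{B'}]=\Gamma_{2}[B'+rI](x, y/x)\,x^{B'+rI}\,(B')_r$ 4. $(y^2\partial_y)^r [y^{B}\,\Gamma_{2}(x/y, y)]=y^{B+rI}\,(B)_r\,\Gamma_{2}[B+rI](x/y, y)$ 5. $(y^2\partial_y)^r [\Gamma_{2}(x/y, y)\,y^{B}]=\Gamma_{2}[B+rI](x/y, y)\,y^{B+rI}\,(B)_r$ if $BB'=B'B$ **$\mathcal{H}_{1}$:** 1. $\partial_x^r \mathcal{H}_{1}(x, y)=(A)_r\,(B)_r\,\mathcal{H}_{1}[A+rI,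 B+rI, C+rI](x, y)\,(C)_r^{-1}$ if $AB=BA$ 2. $\partial_y^r \mathcal{H}_{1}(x, y)=(-1)^r\,(I-A)_r^{-1}\,(B)_r\,\mathcal{H}_{1}[A-rI, B+rI](x, y)$ if $AB=BA$ 3. $(x^2\partial_x)^r [x^{A}\,\mathcal{H}_{1}(x, y/x)]=x^{A+rI}\,(A)_r\,\mathcal{H}_{1}[A+rI](x, y/x)$ 4. $(x^2\partial_x)^r [x^{B}\,\mathcal{H}_{1}(x, xy)]=x^{B+rI}\,(B)_r\,\mathcal{H}_{1}[B+rI](x, xy)$ if $AB=BA$ 5. $\partial_x^r [\mathcal{H}_{1}(x, y)\,x^{C-I}]=(-1)^r\,\mathcal{H}_{1}[C-rI](x, y)\,x^{C-(r+1)I}\,(I-C)_r$ **$\mathcal{H}_{2}$:** 1. $\partial_x^r \mathcal{H}_{2}(x, y)=(A)_r\,(B)_r\,\mathcal{H}_{2}[A+rI, B+rI, C+rI](x, y)\,(C)_r^{-1}$ if $AB=BA$ 2. $\partial_y^r \mathcal{H}_{2}(x, y)=(-1)^r\,(I-A)_r^{-1}\,\mathcal{H}_{2}[A-rI, B'+rI](x,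 y)\,(B')_r$ if $B'C=CB'$ 3. $(x^2\partial_x)^r [x^{A}\,\mathcal{H}_{2}(x, y/x)]=x^{A+rI}\,(A)_r\,\mathcal{H}_{2}[A+rI](x, y/x)$ 4. $(x^2\partial_x)^r [x^{B}\,\mathcal{H}_{2}(x, y)]=x^{B+rI}\,(B)_r\,\mathcal{H}_{2}[B+rI](x, y)$ if $AB=BA$ 5. $(y^2\partial_y)^r [\mathcal{H}_{2}(x, y)\,y^{B'}]=\mathcal{H}_{2}[B'+rI](x, y)\,y^{B'+rI}\,(B')_r$ if $B'C=CB'$ 6. $\partial_x^r [\mathcal{H}_{2}(x, y)\,x^{C-I}]=(-1)^r\,\mathcal{H}_{2}[C-rI](x, y)\,x^{C-(r+1)I}\,(I-C)_r$ **$\mathcal{H}_{3}$:** 1. $\partial_x^r \mathcal{H}_{3}(x, y)=(A)_r\,\mathcal{H}_{3}[A+rI, B+rI, C+rI](x, y)\,(B)_r\,(C)_r^{-1}$ if $BC=CB$ 2. $\partial_y^r \mathcal{H}_{3}(x, y)=(-1)^r\,(I-A)_r^{-1}\,\mathcal{H}_{3}[A-rI](x, y)$ 3. $(x^2\partial_x)^r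 [x^{A}\,\mathcal{H}_{3}(x, y/x)]=x^{A+rI}\,(A)_r\,\mathcal{H}_{3}[A+rI](x, y/x)$ 4. $(x^2\partial_x)^r [\mathcal{H}_{3}(x, y)\,x^{B}]=\mathcal{H}_{3}[B+rI](x, y)\,x^{B+rI}\,(B)_r$ if $BC=CB$ 5. $\partial_x^r [\mathcal{H}_{3}(x, y)\,x^{C-I}]=(-1)^r\,\mathcal{H}_{3}[C-rI](x, y)\,x^{C-(r+1)I}\,(I-C)_r$ **$\mathcal{H}_{4}$:** 1. $\partial_x^r \mathcal{H}_{4}(x, y)=(A)_r\,\mathcal{H}_{4}[A+rI, C+rI](x, y)\,(C)_r^{-1}$ 2. $\partial_y^r \mathcal{H}_{4}(x, y)=(-1)^r\,(I-A)_r^{-1}\,\mathcal{H}_{4}[A-rI, B'+rI](x, y)\,(B')_r$ if $B'C=CB'$ 3. $(x^2\partial_x)^r [x^{A}\,\mathcal{H}_{4}(x, y/x)]=x^{A+rI}\,(A)_r\,\mathcal{H}_{4}[A+rI](x, y/x)$ 4. $(y^2\partial_y)^r [\mathcal{H}_{4}(x, y)\,y^{B'}]=\mathcal{H}_{4}[B'+rI](x,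 y)\,y^{B'+rI}\,(B')_r$ if $B'C=CB'$ 5. $\partial_x^r [\mathcal{H}_{4}(x, y)\,x^{C-I}]=(-1)^r\,\mathcal{H}_{4}[C-rI](x, y)\,x^{C-(r+1)I}\,(I-C)_r$ **$\mathcal{H}_{5}$:** 1. $\partial_x^r \mathcal{H}_{5}(x, y)=(A)_r\,\mathcal{H}_{5}[A+rI, C+rI](x, y)\,(C)_r^{-1}$ 2. $\partial_y^r \mathcal{H}_{5}(x, y)=(-1)^r\,(I-A)_r^{-1}\,\mathcal{H}_{5}[A-rI](x, y)$ 3. $(x^2\partial_x)^r [x^{A}\,\mathcal{H}_{5}(x, y/x)]=x^{A+rI}\,(A)_r\,\mathcal{H}_{5}[A+rI](x, y/x)$ 4. $\partial_x^r [\mathcal{H}_{5}(x, y)\,x^{C-I}]=(-1)^r\,\mathcal{H}_{5}[C-rI](x, y)\,x^{C-(r+1)I}\,(I-C)_r$ **$\mathcal{H}_{6}$:** 1. $\partial_x^r \mathcal{H}_{6}(x, y)=(A)_{2r}\,\mathcal{H}_{6}[A+2rI, C+rI](x, y)\,(C)_r^{-1}$ 2. $\partial_y^r \mathcal{H}_{6}(x,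 y)=(A)_r\,\mathcal{H}_{6}[A+rI, C+rI](x, y)\,(C)_r^{-1}$ 3. $(x^2\partial_x)^r [x^{A}\,\mathcal{H}_{6}(x^2, xy)]=x^{A+rI}\,(A)_r\,\mathcal{H}_{6}[A+rI](x^2, xy)$ 4. $\partial_x^r [\mathcal{H}_{6}(x, xy)\,x^{C-I}]=(-1)^r\,\mathcal{H}_{6}[C-rI](x, xy)\,x^{C-(r+1)I}\,(I-C)_r$ **$\mathcal{H}_{7}$:** 1. $\partial_x^r \mathcal{H}_{7}(x, y)=(A)_{2r}\,\mathcal{H}_{7}[A+2rI, C+rI](x, y)\,(C)_r^{-1}$ if $CC'=C'C$ 2. $\partial_y^r \mathcal{H}_{7}(x, y)=(A)_r\,\mathcal{H}_{7}[A+rI, C'+rI](x, y)\,(C')_r^{-1}$ 3. $(x^2\partial_x)^r [x^{A}\,\mathcal{H}_{7}(x^2, xy)]=x^{A+rI}\,(A)_r\,\mathcal{H}_{7}[A+rI](x^2, xy)$ 4. $\partial_x^r [\mathcal{H}_{7}(x, y)\,x^{C-I}]=(-1)^r\,\mathcal{H}_{7}[C-rI](x, y)\,x^{C-(r+1)I}\,(I-C)_r$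 if $CC'=C'C$ 5. $\partial_y^r [\mathcal{H}_{7}(x, y)\,y^{C'-I}]=(-1)^r\,\mathcal{H}_{7}[C'-rI](x, y)\,y^{C'-(r+1)I}\,(I-C')_r$ **$\mathcal{H}_{8}$:** 1. $\partial_x^r \mathcal{H}_{8}(x, y)=(-1)^r\,(A)_{2r}\,\mathcal{H}_{8}[A+2rI, B-rI](x, y)\,(I-B)_r^{-1}$ 2. $\partial_y^r \mathcal{H}_{8}(x, y)=(-1)^r\,(I-A)_r^{-1}\,\mathcal{H}_{8}[A-rI, B+rI](x, y)\,(B)_r$ 3. $(x^2\partial_x)^r [x^{A}\,\mathcal{H}_{8}(x^2, y/x)]=x^{A+rI}\,(A)_r\,\mathcal{H}_{8}[A+rI](x^2, y/x)$ 4. $(y^2\partial_y)^r [\mathcal{H}_{8}(x/y, y)\,y^{B}]=\mathcal{H}_{8}[B+rI](x/y, y)\,y^{B+rI}\,(B)_r$ **$\mathcal{H}_{9}$:** 1. $\partial_x^r \mathcal{H}_{9}(x, y)=(A)_{2r}\,\mathcal{H}_{9}[A+2rI, C+rI](x, y)\,(C)_r^{-1}$ 2. $\partial_y^r \mathcal{H}_{9}(x,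 y)=(-1)^r\,(I-A)_r^{-1}\,\mathcal{H}_{9}[A-rI, B+rI](x, y)\,(B)_r$ if $BC=CB$ 3. $(x^2\partial_x)^r [x^{A}\,\mathcal{H}_{9}(x^2, y/x)]=x^{A+rI}\,(A)_r\,\mathcal{H}_{9}[A+rI](x^2, y/x)$ 4. $(y^2\partial_y)^r [\mathcal{H}_{9}(x, y)\,y^{B}]=\mathcal{H}_{9}[B+rI](x, y)\,y^{B+rI}\,(B)_r$ if $BC=CB$ 5. $\partial_x^r [\mathcal{H}_{9}(x, y)\,x^{C-I}]=(-1)^r\,\mathcal{H}_{9}[C-rI](x, y)\,x^{C-(r+1)I}\,(I-C)_r$ **$\mathcal{H}_{10}$:** 1. $\partial_x^r \mathcal{H}_{10}(x, y)=(A)_{2r}\,\mathcal{H}_{10}[A+2rI, C+rI](x, y)\,(C)_r^{-1}$ 2. $\partial_y^r \mathcal{H}_{10}(x, y)=(-1)^r\,(I-A)_r^{-1}\,\mathcal{H}_{10}[A-rI](x, y)$ 3. $(x^2\partial_x)^r [x^{A}\,\mathcal{H}_{10}(x^2, y/x)]=x^{A+rI}\,(A)_r\,\mathcal{H}_{10}[A+rI](x^2,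 y/x)$ 4. $\partial_x^r [\mathcal{H}_{10}(x, y)\,x^{C-I}]=(-1)^r\,\mathcal{H}_{10}[C-rI](x, y)\,x^{C-(r+1)I}\,(I-C)_r$ **$\mathcal{H}_{11}$:** 1. $\partial_x^r \mathcal{H}_{11}(x, y)=(A)_r\,\mathcal{H}_{11}[A+rI, C'+rI](x, y)\,(C')_r^{-1}$ 2. $\partial_y^r \mathcal{H}_{11}(x, y)=(-1)^r\,(I-A)_r^{-1}\,(B)_r\,\mathcal{H}_{11}[A-rI, B+rI, C+rI](x, y)\,(C)_r$ if $AB=BA$, $CC'=C'C$ 3. $(x^2\partial_x)^r [x^{A}\,\mathcal{H}_{11}(x, y/x)]=x^{A+rI}\,(A)_r\,\mathcal{H}_{11}[A+rI](x, y/x)$ 4. $(y^2\partial_y)^r [y^{B}\,\mathcal{H}_{11}(x, y)]=y^{B+rI}\,(B)_r\,\mathcal{H}_{11}[B+rI](x, y)$ if $AB=BA$ 5. $\partial_x^r [\mathcal{H}_{11}(x, y)\,x^{C'-I}]=(-1)^r\,\mathcal{H}_{11}[C'-rI](x, y)\,x^{C'-(r+1)I}\,(I-C')_r$ -/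

import Mathlib

open scoped Matrix.Norms.L2Operator

namespace HornMatrix

/-- Square complex matrices of size `N`, with the operator norm induced by the Euclidean norm. -/
abbrev Mat (N : ℕ) := Matrix (Fin N) (Fin N) ℂ

/-- The Pochhammer symbol with integer index: `(A)_n = A (A + I) ⋯ (A + (n - 1) I)` for `n ≥ 0` and
`(A)_{-n} = (-1)^n ((I - A)_n)⁻¹` for `n ≥ 1`. -/
noncomputable def poch {N : ℕ} (A : Mat N) : ℤ → Mat N
  | Int.ofNat n => Polynomial.aeval A (ascPochhammer ℂ n)
  | Int.negSucc n => (-1) ^ (n + 1) * (Polynomial.aeval (1 - A) (ascPochhammer ℂ (n + 1)))⁻¹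

/-- `C + k I` is invertible for every integer `k ≥ 0`: all the symbols `(C)_n`, `n ≥ 0`, are
invertible. -/
def PosReg {N : ℕ} (C : Mat N) : Prop := ∀ k : ℕ, IsUnit (C + k • 1)

/-- `A - k I` is invertible for every integer `k ≥ 1`: all the symbols `(A)_{-n}`, `n ≥ 0`, are
defined. -/
def NegReg {N : ℕ} (A : Mat N) : Prop := ∀ k : ℕ, IsUnit (A - (k + 1) • 1)

/-- The matrix power `z ^ P = exp (P log z)`, with the principal branch of the logarithm. -/
noncomputable def mpow {N : ℕ} (z : ℂ) (P : Mat N) : Mat N :=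
  NormedSpace.exp (Complex.log z • P)

/-- The data of a double series `∑ c m n x^m y^n / (m! n!)`: its matrix coefficients `c m n`, and the
condition on the parameters under which all of them are defined. -/
structure Series (N : ℕ) where
  coeff : ℕ → ℕ → Mat N
  regular : Prop

/-- The term of index `k = (m, n)` of the double series at the point `p = (x, y)`. -/
noncomputable def Series.term {N : ℕ} (S : Series N) (p : ℂ × ℂ) (k : ℕ × ℕ) : Mat N :=
  (p.1 ^ k.1 * p.2 ^ k.2 / (k.1.factorial * k.2.factorial : ℂ)) • S.coeff k.1 k.2

/-- The sum of the double series. -/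
noncomputable def Series.eval {N : ℕ} (S : Series N) (p : ℂ × ℂ) : Mat N :=
  ∑' k : ℕ × ℕ, S.term p k

noncomputable instance {N : ℕ} : CoeFun (Series N) fun _ => ℂ × ℂ → Mat N := ⟨Series.eval⟩

/-- The domain of the matrix function: it is empty if some coefficient is undefined, and else it is
the region of absolute convergence, that is, the interior of the set of points at which the double
series converges absolutely. -/
def Series.dom {N : ℕ} (S : Series N) : Set (ℂ × ℂ) :=
  {p | S.regular ∧ p ∈ interior {q : ℂ × ℂ | Summable fun k => ‖S.term q k‖}}

/-- The operator `z² d/dz`. -/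
noncomputable def sqDeriv {N : ℕ} (f : ℂ → Mat N) : ℂ → Mat N := fun z => z ^ 2 • deriv f z

/-- `f` is analytic at `z`, and the `r`-th iterate of the operator `D`, applied to `f`, takes the
value `v` at `z`. -/
def IteratesTo {N : ℕ} (D : (ℂ → Mat N) → ℂ → Mat N) (r : ℕ) (f : ℂ → Mat N) (z : ℂ) (v : Mat N) :
    Prop :=
  AnalyticAt ℂ f z ∧ D^[r] f z = v

/-- `∂^r/∂x^r S(x, y) = L T(x, y) R` wherever both sides are defined. -/
def DiffX {N : ℕ} (r : ℕ) (S : Series N) (L : Mat N) (T : Series N) (R : Mat N) : Prop :=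
  ∀ x y : ℂ, (x, y) ∈ S.dom ∩ T.dom →
    IteratesTo deriv r (fun z => S (z, y)) x (L * T (x, y) * R)

/-- `∂^r/∂y^r S(x, y) = L T(x, y) R` wherever both sides are defined. -/
def DiffY {N : ℕ} (r : ℕ) (S : Series N) (L : Mat N) (T : Series N) (R : Mat N) : Prop :=
  ∀ x y : ℂ, (x, y) ∈ S.dom ∩ T.dom →
    IteratesTo deriv r (fun z => S (x, z)) y (L * T (x, y) * R)

/-- `(z² d/dz)^r [z^P S(γ(z))] = z^(P + r I) (P)_r T(γ(z))` wherever both sides are defined. -/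
def PowLeft {N : ℕ} (r : ℕ) (P : Mat N) (S T : Series N) (γ : ℂ → ℂ × ℂ) : Prop :=
  ∀ z ∈ Complex.slitPlane, γ z ∈ S.dom ∩ T.dom →
    IteratesTo sqDeriv r (fun z => mpow z P * S (γ z)) z
      (mpow z (P + r • 1) * poch P r * T (γ z))

/-- `(z² d/dz)^r [S(γ(z)) z^P] = T(γ(z)) z^(P + r I) (P)_r` wherever both sides are defined. -/
def PowRight {N : ℕ} (r : ℕ) (P : Mat N) (S T : Series N) (γ : ℂ → ℂ × ℂ) : Prop :=
  ∀ z ∈ Complex.slitPlane, γ z ∈ S.dom ∩ T.dom →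
    IteratesTo sqDeriv r (fun z => S (γ z) * mpow z P) z
      (T (γ z) * mpow z (P + r • 1) * poch P r)

/-- `d^r/dz^r [S(γ(z)) z^(C - I)] = (-1)^r T(γ(z)) z^(C - (r + 1) I) (I - C)_r` wherever both sides
are defined. -/
def PowLower {N : ℕ} (r : ℕ) (C : Mat N) (S T : Series N) (γ : ℂ → ℂ × ℂ) : Prop :=
  ∀ z ∈ Complex.slitPlane, γ z ∈ S.dom ∩ T.dom →
    IteratesTo deriv r (fun z => S (γ z) * mpow z (C - 1)) z
      ((-1) ^ r * T (γ z) * mpow z (C - (r + 1) • 1) * poch (1 - C) r)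

/-- The Horn function `G₂`. -/
noncomputable def G2 {N : ℕ} (A A' B B' : Mat N) : Series N where
  coeff m n := poch A m * poch A' n * poch B (n - m) * poch B' (m - n)
  regular := NegReg B ∧ NegReg B'

/-- The Horn function `G₃`. -/
noncomputable def G3 {N : ℕ} (A A' : Mat N) : Series N where
  coeff m n := poch A (2 * n - m) * poch A' (2 * m - n)
  regular := NegReg A ∧ NegReg A'

/-- The Horn function `H₁`. -/
noncomputable def H1 {N : ℕ} (A B C C' : Mat N) : Series N where
  coeff m n := poch A (m - n) * poch B (m + n) * poch C n * (poch C' m)⁻¹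
  regular := NegReg A ∧ PosReg C'

/-- The Horn function `H₂`. -/
noncomputable def H2 {N : ℕ} (A B C C' C'' : Mat N) : Series N where
  coeff m n := poch A (m - n) * poch B m * poch C n * poch C' n * (poch C'' m)⁻¹
  regular := NegReg A ∧ PosReg C''

/-- The Horn function `H₃`. -/
noncomputable def H3 {N : ℕ} (A B C : Mat N) : Series N where
  coeff m n := poch A (2 * m + n) * poch B n * (poch C (m + n))⁻¹
  regular := PosReg C

/-- The Horn function `H₄`. -/
noncomputable def H4 {N : ℕ} (A B C C' : Mat N) : Series N where
  coeff m n := poch A (2 * m + n) * poch B n * (poch C m)⁻¹ * (poch C' n)⁻¹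
  regular := PosReg C ∧ PosReg C'

/-- The Horn function `H₅`. -/
noncomputable def H5 {N : ℕ} (A B C : Mat N) : Series N where
  coeff m n := poch A (2 * m + n) * poch B (n - m) * (poch C n)⁻¹
  regular := NegReg B ∧ PosReg C

/-- The Horn function `H₆`. -/
noncomputable def H6 {N : ℕ} (A B C : Mat N) : Series N where
  coeff m n := poch A (2 * m - n) * poch B (n - m) * poch C n
  regular := NegReg A ∧ NegReg B

/-- The Horn function `H₇`. -/
noncomputable def H7 {N : ℕ} (A B C C' : Mat N) : Series N where
  coeff m n := poch A (2 * m - n) * poch B n * poch C n * (poch C' m)⁻¹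
  regular := NegReg A ∧ PosReg C'

/-- The confluent function `Γ₁`. -/
noncomputable def Γ1 {N : ℕ} (A B B' : Mat N) : Series N where
  coeff m n := poch A m * poch B (n - m) * poch B' (m - n)
  regular := NegReg B ∧ NegReg B'

/-- The confluent function `Γ₂`. -/
noncomputable def Γ2 {N : ℕ} (B B' : Mat N) : Series N where
  coeff m n := poch B (n - m) * poch B' (m - n)
  regular := NegReg B ∧ NegReg B'

/-- The confluent function `ℋ₁`. -/
noncomputable def ℋ1 {N : ℕ} (A B C : Mat N) : Series N where
  coeff m n := poch A (m - n) * poch B (m + n) * (poch C m)⁻¹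
  regular := NegReg A ∧ PosReg C

/-- The confluent function `ℋ₂`. -/
noncomputable def ℋ2 {N : ℕ} (A B B' C : Mat N) : Series N where
  coeff m n := poch A (m - n) * poch B m * poch B' n * (poch C m)⁻¹
  regular := NegReg A ∧ PosReg C

/-- The confluent function `ℋ₃`. -/
noncomputable def ℋ3 {N : ℕ} (A B C : Mat N) : Series N where
  coeff m n := poch A (m - n) * poch B m * (poch C m)⁻¹
  regular := NegReg A ∧ PosReg C

/-- The confluent function `ℋ₄`. -/
noncomputable def ℋ4 {N : ℕ} (A B' C : Mat N) : Series N where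
  coeff m n := poch A (m - n) * poch B' n * (poch C m)⁻¹
  regular := NegReg A ∧ PosReg C

/-- The confluent function `ℋ₅`. -/
noncomputable def ℋ5 {N : ℕ} (A C : Mat N) : Series N where
  coeff m n := poch A (m - n) * (poch C m)⁻¹
  regular := NegReg A ∧ PosReg C

/-- The confluent function `ℋ₆`. -/
noncomputable def ℋ6 {N : ℕ} (A C : Mat N) : Series N where
  coeff m n := poch A (2 * m + n) * (poch C (m + n))⁻¹
  regular := PosReg C

/-- The confluent function `ℋ₇`. -/
noncomputable def ℋ7 {N : ℕ} (A C C' : Mat N) : Series N where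
  coeff m n := poch A (2 * m + n) * (poch C m)⁻¹ * (poch C' n)⁻¹
  regular := PosReg C ∧ PosReg C'

/-- The confluent function `ℋ₈`. -/
noncomputable def ℋ8 {N : ℕ} (A B : Mat N) : Series N where
  coeff m n := poch A (2 * m - n) * poch B (n - m)
  regular := NegReg A ∧ NegReg B

/-- The confluent function `ℋ₉`. -/
noncomputable def ℋ9 {N : ℕ} (A B C : Mat N) : Series N where
  coeff m n := poch A (2 * m - n) * poch B n * (poch C m)⁻¹
  regular := NegReg A ∧ PosReg C

/-- The confluent function `ℋ₁₀`. -/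
noncomputable def ℋ10 {N : ℕ} (A C : Mat N) : Series N where
  coeff m n := poch A (2 * m - n) * (poch C m)⁻¹
  regular := NegReg A ∧ PosReg C

/-- The confluent function `ℋ₁₁`. -/
noncomputable def ℋ11 {N : ℕ} (A B C C' : Mat N) : Series N where
  coeff m n := poch A (m - n) * poch B n * poch C n * (poch C' m)⁻¹
  regular := NegReg A ∧ PosReg C'

end HornMatrix

open HornMatrix

namespace HornMatrix

variable {N : ℕ}

/-! Every formula is an identity between coefficients once the series may be differentiated term by
term. Near a point of the region of absolute convergence, the terms are dominated by their norms at
a point with strictly larger coordinates in modulus (`Series.exists_bound`), so the Weierstrass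
theorem applies. The derived series is summable at every point of the same open region, hence
absolutely, the matrices being finite-dimensional (`Series.subset_region`); so differentiation can
be iterated without losing points.

Plain derivatives: because of the factorials, `∂_x^r` replaces `c_{m,n}` by `c_{m+r,n}`. The shifted
symbols are rewritten by `(A)_{k+r} = (A)_r (A+rI)_k` (`poch_shift`) and `(A)_{k-r} = (-1)^r
(I-A)_r⁻¹ (A-rI)_k` (`poch_sub_natCast`). The constants so produced must be carried to the left or
right end of the product, and the listed commutativity hypotheses are what they need to cross the
symbols in between.

Formulas with a matrix power: along `z ↦ (x z^a, y z^b)` the term of index `(m, n)` is homogeneous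
of degree `κ = a m + b n`, and the curve is chosen so that `κ` is the index at which the parameter
occurs in the coefficient. Applying `z² d/dz` `r` times to `z^{P+κ}` gives `(P+κ)_r z^{P+κ+r}`, and
`(P+κ)_r (P)_κ = (P)_{κ+r} = (P)_r (P+rI)_κ` (`poch_mul_poch`). Applying `d/dz` `r` times to
`z^{C-I+κ}` gives the factor `(C-rI+κ)_r`, which turns `(C)_κ⁻¹` into `(C-rI)_κ⁻¹ (-1)^r (I-C)_r`
(`poch_inv_mul_poch`). Here commutativity lets the multiplier reach the symbol it combines with. -/

/-! ### Commutation of symbols, inverses and shifts. -/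

theorem commute_inv_right {X A : Mat N} (h : Commute X A) : Commute X A⁻¹ := by
  -- No invertibility is needed: the inverse of a singular matrix is `0`, which commutes with
  -- everything.
  simpa using Matrix.Commute.zpow_right h (-1)

theorem commute_aeval_right {X A : Mat N} (h : Commute X A) (p : Polynomial ℂ) :
    Commute X (Polynomial.aeval A p) := by
  induction p using Polynomial.induction_on' with
  | add p q hp hq => simpa using hp.add_right hq
  | monomial n a =>
    rw [Polynomial.aeval_monomial]
    exact (Algebra.commute_algebraMap_right a X).mul_right (h.pow_right n)

theorem commute_poch_right {X A : Mat N} (h : Commute X A) (k : ℤ) : Commute X (poch A k) := by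
  cases k with
  | ofNat n => exact commute_aeval_right h _
  | negSucc n =>
    exact ((Commute.one_right X).neg_right.pow_right _).mul_right
      (commute_inv_right (commute_aeval_right ((Commute.one_right X).sub_right h) _))

theorem commute_poch_left {X A : Mat N} (h : Commute A X) (k : ℤ) : Commute (poch A k) X :=
  (commute_poch_right h.symm k).symm

theorem commute_inv_left {X A : Mat N} (h : Commute A X) : Commute A⁻¹ X :=
  (commute_inv_right h.symm).symm

theorem commute_add_right {X A : Mat N} (h : Commute X A) (r : ℕ) : Commute X (A + r • 1) :=
  h.add_right ((Commute.one_right X).smul_right r)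

theorem commute_add_left {X A : Mat N} (h : Commute A X) (r : ℕ) : Commute (A + r • 1) X :=
  (commute_add_right h.symm r).symm

theorem commute_sub_right {X A : Mat N} (h : Commute X A) (r : ℕ) : Commute X (A - r • 1) :=
  h.sub_right ((Commute.one_right X).smul_right r)

theorem commute_sub_left {X A : Mat N} (h : Commute A X) (r : ℕ) : Commute (A - r • 1) X :=
  (commute_sub_right h.symm r).symm

theorem commute_one_sub_left {X A : Mat N} (h : Commute A X) : Commute (1 - A) X :=
  (Commute.one_left X).sub_left h

theorem commute_one_sub_right {X A : Mat N} (h : Commute X A) : Commute X (1 - A) :=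
  (Commute.one_right X).sub_right h

theorem commute_add_intCast_left {X A : Mat N} (h : Commute A X) (k : ℤ) : Commute (A + k) X :=
  h.add_left (Int.cast_commute k X)

theorem commute_neg_one_pow_left (X : Mat N) (r : ℕ) : Commute ((-1) ^ r) X :=
  (Commute.one_left X).neg_left.pow_left r

theorem commute_neg_one_pow_right (X : Mat N) (r : ℕ) : Commute X ((-1) ^ r) :=
  (commute_neg_one_pow_left X r).symm

/-! ### Pochhammer symbols with integer index. -/

@[simp]
theorem poch_zero (A : Mat N) : poch A 0 = 1 := by
  change Polynomial.aeval A (ascPochhammer ℂ 0) = 1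
  simp

theorem poch_natCast_add_one (A : Mat N) (n : ℕ) :
    poch A ((n : ℤ) + 1) = poch A n * (A + (n : Mat N)) := by
  change Polynomial.aeval A (ascPochhammer ℂ (n + 1)) = Polynomial.aeval A (ascPochhammer ℂ n) * _
  simp [ascPochhammer_succ_right]

theorem poch_neg_natCast (A : Mat N) (n : ℕ) :
    poch A (-(n : ℤ)) = (-1) ^ n * (poch (1 - A) n)⁻¹ := by
  cases n with
  | zero => simp
  | succ n => rfl

theorem NegReg.isUnit_sub {A : Mat N} (h : NegReg A) (n : ℕ) : IsUnit (A - ((n : Mat N) + 1)) := by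
  simpa using h n

/-- The Pochhammer symbol `(A)_k` satisfies its recursion at `k` if `k ≥ 0`, or if all of its
symbols with negative index are defined. -/
theorem poch_add_one {A : Mat N} {k : ℤ} (h : 0 ≤ k ∨ NegReg A) :
    poch A (k + 1) = poch A k * (A + (k : Mat N)) := by
  obtain ⟨n, rfl | rfl⟩ := k.eq_nat_or_neg
  · simpa using poch_natCast_add_one A n
  cases n with
  | zero => simpa using poch_natCast_add_one A 0
  | succ n =>
    have hA : NegReg A := h.resolve_left (by push_cast; omega)
    have e : -((n + 1 : ℕ) : ℤ) + 1 = -(n : ℤ) := by push_cast; ring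
    -- `1 - A + n` is the last factor of `(I - A)_{n+1}`. It is minus the factor `A - (n + 1)` of
    -- the recursion, so the two cancel, which accounts for the change of sign.
    have hu : IsUnit (1 - A + (n : Mat N)) := by
      have := (hA.isUnit_sub n).neg
      rwa [show -(A - ((n : Mat N) + 1)) = 1 - A + (n : Mat N) by abel] at this
    have hdet := (Matrix.isUnit_iff_isUnit_det _).1 hu
    have hc : Commute (1 - A + (n : Mat N)) (poch (1 - A) n)⁻¹ :=
      commute_inv_right (commute_poch_right ((Commute.refl (1 - A)).add_left
        (Nat.cast_commute n (1 - A))) n)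
    rw [e, poch_neg_natCast, poch_neg_natCast]
    rw [Nat.cast_add_one, poch_natCast_add_one, Matrix.mul_inv_rev]
    rw [show A + ((-((n : ℤ) + 1) : ℤ) : Mat N) = -(1 - A + (n : Mat N)) by push_cast; abel]
    rw [pow_succ, mul_neg_one, neg_mul, neg_mul_neg, mul_assoc, mul_assoc, ← hc.eq,
      ← mul_assoc _ (1 - A + (n : Mat N)), Matrix.nonsing_inv_mul _ hdet, one_mul]

/-- Splits the symbol after index `k`, whereas `poch_shift` splits off `(A)_r` in front; comparing
the two splittings gives `poch_mul_poch` and `poch_inv_mul_poch`. -/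
theorem poch_add_natCast {A : Mat N} {k : ℤ} (h : 0 ≤ k ∨ NegReg A) (r : ℕ) :
    poch A (k + r) = poch A k * poch (A + (k : Mat N)) r := by
  induction r with
  | zero => simp
  | succ r ih =>
    have e : k + ((r + 1 : ℕ) : ℤ) = k + r + 1 := by push_cast; ring
    rw [e, poch_add_one (h.imp_left fun hk => by positivity), ih, Nat.cast_add_one,
      poch_natCast_add_one]
    push_cast
    rw [mul_assoc, add_assoc]

/-- For `k ≥ 0` the product is cut after its first `r` factors. For negative `k` the induction
descends: from `-(n + 1)` to `-n` both sides acquire the same right factor `A + r - (n + 1)`, which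
is cancellable by `NegReg (A + r • 1)`, while `NegReg A` justifies the recursion on the left side.
-/
theorem poch_shift {A : Mat N} {k : ℤ} (r : ℕ)
    (h : 0 ≤ k ∨ (NegReg A ∧ NegReg (A + r • 1))) :
    poch A (k + r) = poch A r * poch (A + r • 1) k := by
  have hpos : ∀ n : ℕ, poch A ((n : ℤ) + r) = poch A r * poch (A + r • 1) n := fun n => by
    rw [add_comm, poch_add_natCast (Or.inl (Int.natCast_nonneg r))]
    simp
  obtain ⟨n, rfl | rfl⟩ := k.eq_nat_or_neg
  · exact hpos n
  -- The index `-0` is set apart because there `h` may hold by its first alternative. Once the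
  -- regularity hypotheses are extracted, positivity of `n` is dropped so that the induction can
  -- start at `0`.
  rcases Nat.eq_zero_or_pos n with rfl | hn
  · exact hpos 0
  obtain ⟨hA, hA'⟩ := h.resolve_left (by omega)
  clear hn
  induction n with
  | zero => exact hpos 0
  | succ n ih =>
    have hu := hA'.isUnit_sub n
    refine hu.mul_right_cancel ?_
    have e1 := poch_add_one (A := A) (k := -((n + 1 : ℕ) : ℤ) + r) (Or.inr hA)
    have e2 := poch_add_one (A := A + r • 1) (k := -((n + 1 : ℕ) : ℤ)) (Or.inr hA')
    rw [show -((n + 1 : ℕ) : ℤ) + r + 1 = -(n : ℤ) + r by push_cast; ring, ih (Or.inr ⟨hA, hA'⟩)] at e1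
    rw [show -((n + 1 : ℕ) : ℤ) + 1 = -(n : ℤ) by push_cast; ring] at e2
    rw [mul_assoc, show A + r • (1 : Mat N) - ((n : Mat N) + 1)
      = A + r • 1 + ((-((n + 1 : ℕ) : ℤ) : ℤ) : Mat N) by push_cast; abel, ← e2, e1]
    congr 1
    push_cast
    simp only [nsmul_eq_mul, mul_one]
    abel

/-- The factors `A - r, …, A - 1` are the negatives of the factors `1 - A, …, r - A` of `(I - A)_r`,
in reverse order. -/
theorem poch_sub_self (A : Mat N) (r : ℕ) : poch (A - r • 1) r = (-1) ^ r * poch (1 - A) r := by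
  induction r with
  | zero => simp
  | succ r ih =>
    have e := poch_shift (A := A - (r + 1) • 1) (k := r) 1 (Or.inl (Int.natCast_nonneg r))
    have hc : Commute (1 - A + (r : Mat N)) (poch (1 - A) r) :=
      commute_poch_right ((Commute.refl (1 - A)).add_left (Nat.cast_commute r (1 - A))) r
    have h1 : poch (A - (r + 1) • 1) 1 = -(1 - A + (r : Mat N)) := by
      have := poch_natCast_add_one (A - (r + 1) • 1) 0
      simp only [Nat.cast_zero, zero_add, poch_zero, one_mul, add_zero] at this
      rw [this, nsmul_one]
      push_cast
      abel
    rw [show A - (r + 1) • (1 : Mat N) + 1 • 1 = A - r • 1 by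
      rw [add_smul]; abel, ih, Nat.cast_one, h1] at e
    rw [Nat.cast_add_one, e, poch_natCast_add_one, pow_succ, mul_neg_one, neg_mul, neg_mul,
      ← mul_assoc, ← (commute_neg_one_pow_left (1 - A + (r : Mat N)) r).eq, mul_assoc, hc.eq]

/-- Lowering a parameter only drops conditions, so the lowering rules need regularity of `A` alone.
Raising it adds conditions, which must come from the regularity of the second function. -/
theorem NegReg.sub {A : Mat N} (h : NegReg A) (r : ℕ) : NegReg (A - r • 1) := fun k => by
  have := h (r + k)
  rwa [show A - (r + k + 1) • (1 : Mat N) = A - r • 1 - (k + 1) • 1 by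
    simp only [add_smul, one_smul]; abel] at this

theorem NegReg.isUnit_poch {A : Mat N} (h : NegReg A) (r : ℕ) : IsUnit (poch (1 - A) r) := by
  induction r with
  | zero => simp
  | succ r ih =>
    rw [Nat.cast_add_one, poch_natCast_add_one]
    refine ih.mul ?_
    have := (h.isUnit_sub r).neg
    rwa [show -(A - ((r : Mat N) + 1)) = 1 - A + (r : Mat N) by abel] at this

/-- This is `poch_shift` at the parameter `A - r I`, solved for the other symbol: the constant there
is `(A - r I)_r = (-1)^r (I - A)_r`, invertible by `NegReg A`. -/
theorem poch_sub_natCast {A : Mat N} (h : NegReg A) (k : ℤ) (r : ℕ) :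
    poch A (k - r) = (-1) ^ r * (poch (1 - A) r)⁻¹ * poch (A - r • 1) k := by
  have e := poch_shift (A := A - r • 1) (k := k - r) r (Or.inr ⟨h.sub r, by simpa using h⟩)
  rw [sub_add_cancel, sub_add_cancel, poch_sub_self] at e
  have hdet := (Matrix.isUnit_iff_isUnit_det _).1 (h.isUnit_poch r)
  have hs : ((-1 : Mat N) ^ r) * (-1) ^ r = 1 := by rw [← pow_add, ← two_mul, pow_mul]; simp
  rw [e, mul_assoc, (commute_neg_one_pow_left (poch (1 - A) r) r).eq, mul_assoc,
    ← mul_assoc _ (poch (1 - A) r), Matrix.nonsing_inv_mul _ hdet, one_mul, ← mul_assoc, hs,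
    one_mul]

theorem PosReg.isUnit_poch {C : Mat N} (h : PosReg C) (n : ℕ) : IsUnit (poch C n) := by
  induction n with
  | zero => simp
  | succ n ih =>
    rw [Nat.cast_add_one, poch_natCast_add_one]
    exact ih.mul (by simpa using h n)

/-- The change of the left factor of a coefficient under `r` applications of the operator
`z ^ 2 d/dz` to a function with the factor `z ^ P`. -/
theorem poch_mul_poch {P : Mat N} {k : ℤ} (r : ℕ)
    (h : 0 ≤ k ∨ (NegReg P ∧ NegReg (P + r • 1))) :
    poch (P + (k : Mat N)) r * poch P k = poch P r * poch (P + r • 1) k := by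
  -- Both sides are `(P)_{k+r}`.
  rw [← poch_shift r h, poch_add_natCast (h.imp_right And.left)]
  exact (commute_poch_left (commute_poch_right (commute_add_intCast_left (Commute.refl P) k) k) r).eq

/-- The change of an inverse factor of a coefficient under `r` derivatives of a function with the
factor `z ^ (C - 1)`. -/
theorem poch_inv_mul_poch {C : Mat N} {k : ℤ} (r : ℕ) (hk : 0 ≤ k) (h : PosReg C)
    (h' : PosReg (C - r • 1)) :
    (poch C k)⁻¹ * poch (C - r • 1 + (k : Mat N)) r
      = (poch (C - r • 1) k)⁻¹ * ((-1) ^ r * poch (1 - C) r) := by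
  -- The product `(C - r) ⋯ (C + k - 1)` is split in two ways: after its first `k` factors, and
  -- after its first `r` factors.
  have e1 := poch_add_natCast (A := C - r • 1) (k := k) (Or.inl hk) r
  have e2 := poch_shift (A := C - r • 1) (k := k) r (Or.inl hk)
  rw [sub_add_cancel, poch_sub_self] at e2
  rw [e2] at e1
  have hd : IsUnit (poch C k).det := by
    lift k to ℕ using hk
    exact (Matrix.isUnit_iff_isUnit_det _).1 (h.isUnit_poch k)
  have hd' : IsUnit (poch (C - r • 1) k).det := by
    lift k to ℕ using hk
    exact (Matrix.isUnit_iff_isUnit_det _).1 (h'.isUnit_poch k)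
  have hc : Commute (poch C k)⁻¹ ((-1) ^ r * poch (1 - C) r * poch C k) := by
    refine commute_inv_left (commute_poch_left ?_ k)
    exact ((commute_neg_one_pow_right C r).mul_right
      (commute_poch_right (commute_one_sub_right (Commute.refl C)) r)).mul_right
      (commute_poch_right (Commute.refl C) k)
  have e3 : poch (C - r • 1 + (k : Mat N)) r
      = (poch (C - r • 1) k)⁻¹ * ((-1) ^ r * poch (1 - C) r * poch C k) := by
    rw [e1, ← mul_assoc, Matrix.nonsing_inv_mul _ hd', one_mul]
  have hc' : Commute (poch C k)⁻¹ (poch (C - r • 1) k)⁻¹ :=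
    commute_inv_left (commute_poch_left (commute_inv_right (commute_poch_right
      (commute_sub_right (Commute.refl C) r) k)) k)
  rw [e3, ← mul_assoc, hc'.eq, mul_assoc, hc.eq, mul_assoc, Matrix.mul_nonsing_inv _ hd, mul_one]

/-! ### Absolute convergence and termwise differentiation. -/

/-- The region of absolute convergence of a double series. -/
def Series.region (S : Series N) : Set (ℂ × ℂ) :=
  interior {q : ℂ × ℂ | Summable fun k => ‖S.term q k‖}

theorem Series.isOpen_region (S : Series N) : IsOpen S.region := isOpen_interior

theorem Series.summable_term {S : Series N} {p : ℂ × ℂ} (h : p ∈ S.region) :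
    Summable (S.term p) :=
  Summable.of_norm (f := S.term p)
    (interior_subset (s := {q : ℂ × ℂ | Summable fun k => ‖S.term q k‖}) h)

/-- The series with prescribed coefficients and no condition on the parameters. -/
def ofCoeff (c : ℕ → ℕ → Mat N) : Series N := ⟨c, True⟩

/-- Move outward along the ray through `x`, or along the positive real axis if `x = 0`. This
supplies the strictly larger radii of the dominating polydisc. -/
theorem exists_norm_gt_of_mem_nhds {U : Set ℂ} {x : ℂ} (hU : U ∈ nhds x) :
    ∃ x' ∈ U, ‖x‖ < ‖x'‖ := by
  have h1 : Filter.Tendsto (fun t : ℝ => x + t * (if x = 0 then 1 else x)) (nhdsWithin 0 (Set.Ioi 0))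
      (nhds x) := by
    have : Continuous fun t : ℝ => x + t * (if x = 0 then 1 else x) := by fun_prop
    simpa using (this.tendsto 0).mono_left nhdsWithin_le_nhds
  obtain ⟨t, htU, ht⟩ := ((h1.eventually_mem hU).and self_mem_nhdsWithin).exists
  refine ⟨_, htU, ?_⟩
  have ht0 : (0 : ℝ) < t := ht
  by_cases hx : x = 0
  · simp [hx, ht0.ne']
  · have hxn : 0 < ‖x‖ := norm_pos_iff.2 hx
    have h2 : x + t * x = ((1 + t : ℝ) : ℂ) * x := by push_cast; ring
    rw [if_neg hx, h2, norm_mul, Complex.norm_of_nonneg (by positivity)]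
    nlinarith

theorem Series.norm_term_le (S : Series N) {p q : ℂ × ℂ} (h1 : ‖p.1‖ ≤ ‖q.1‖) (h2 : ‖p.2‖ ≤ ‖q.2‖)
    (k : ℕ × ℕ) : ‖S.term p k‖ ≤ ‖S.term q k‖ := by
  simp only [Series.term, norm_smul, norm_div, norm_mul, norm_pow]
  gcongr

/-- The terms of the series are dominated by a convergent series near each point of the region of
absolute convergence. -/
theorem Series.exists_bound {S : Series N} {p : ℂ × ℂ} (hp : p ∈ S.region) :
    ∃ V : Set (ℂ × ℂ), IsOpen V ∧ p ∈ V ∧ ∃ u : ℕ × ℕ → ℝ, Summable u ∧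
      ∀ k, ∀ q ∈ V, ‖S.term q k‖ ≤ u k := by
  obtain ⟨U₁, hU₁, U₂, hU₂, hU⟩ := mem_nhds_prod_iff.1 (mem_interior_iff_mem_nhds.1 hp)
  obtain ⟨x', hx', hx⟩ := exists_norm_gt_of_mem_nhds hU₁
  obtain ⟨y', hy', hy⟩ := exists_norm_gt_of_mem_nhds hU₂
  -- The neighbourhood is the open polydisc with `(x', y')` on its distinguished boundary. The
  -- series converges absolutely at that point, and its terms there bound those inside.
  refine ⟨{q | ‖q.1‖ < ‖x'‖ ∧ ‖q.2‖ < ‖y'‖}, ?_, ⟨hx, hy⟩, fun k => ‖S.term (x', y') k‖,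
    hU (Set.mk_mem_prod hx' hy'), fun k q hq => S.norm_term_le hq.1.le hq.2.le k⟩
  exact (isOpen_lt (continuous_fst.norm) continuous_const).inter
    (isOpen_lt (continuous_snd.norm) continuous_const)

/-- The hypotheses of the Weierstrass theorem for the terms along `γ`. Differentiability of `γ` is
asked only near `z`, since curves such as `z ↦ (z, y / z)` are singular at `0`. -/
theorem Series.exists_nhds {S : Series N} {γ : ℂ → ℂ × ℂ} {z : ℂ}
    (hγ : ∀ᶠ w in nhds z, DifferentiableAt ℂ γ w) (hz : γ z ∈ S.region) :
    ∃ U : Set ℂ, IsOpen U ∧ z ∈ U ∧ (∀ k, DifferentiableOn ℂ (fun w => S.term (γ w) k) U) ∧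
      ∃ u : ℕ × ℕ → ℝ, Summable u ∧ ∀ k, ∀ w ∈ U, ‖S.term (γ w) k‖ ≤ u k := by
  obtain ⟨V, hV, hzV, u, hu, hle⟩ := S.exists_bound hz
  have hVz : ∀ᶠ w in nhds z, γ w ∈ V :=
    hγ.self_of_nhds.continuousAt.eventually_mem (hV.mem_nhds hzV)
  obtain ⟨U, hU, hUo, hzU⟩ := eventually_nhds_iff.1 (hγ.and hVz)
  refine ⟨U, hUo, hzU, fun k w hw => ?_, u, hu, fun k w hw => hle k _ (hU w hw).2⟩
  have := (hU w hw).1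
  unfold Series.term
  exact DifferentiableAt.differentiableWithinAt (by fun_prop)

theorem Series.analyticAt_comp {S : Series N} {γ : ℂ → ℂ × ℂ} {z : ℂ}
    (hγ : ∀ᶠ w in nhds z, DifferentiableAt ℂ γ w) (hz : γ z ∈ S.region) :
    AnalyticAt ℂ (fun w => S (γ w)) z := by
  obtain ⟨U, hU, hzU, hd, u, hu, hle⟩ := S.exists_nhds hγ hz
  exact (Complex.differentiableOn_tsum_of_summable_norm hu hd hU hle).analyticAt (hU.mem_nhds hzU)

theorem Series.hasSum_deriv_comp {S : Series N} {γ : ℂ → ℂ × ℂ} {z : ℂ}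
    (hγ : ∀ᶠ w in nhds z, DifferentiableAt ℂ γ w) (hz : γ z ∈ S.region) :
    HasSum (fun k => deriv (fun w => S.term (γ w) k) z) (deriv (fun w => S (γ w)) z) := by
  obtain ⟨U, hU, hzU, hd, u, hu, hle⟩ := S.exists_nhds hγ hz
  exact Complex.hasSum_deriv_of_summable_norm hu hd hU hle hzU

/-- In finite dimension summability is absolute, and an open set of points of absolute convergence
lies in the interior of the set of all of them. -/
theorem Series.subset_region {S T : Series N} (h : ∀ p ∈ S.region, Summable (T.term p)) :
    S.region ⊆ T.region :=
  interior_maximal (fun p hp => (h p hp).norm) S.isOpen_region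

/-! ### Derivatives in one of the variables -/

/-- The factor `m + 1` produced by differentiating `x^(m+1)` reduces `1/(m+1)!` to `1/m!`, so `∂_x`
merely shifts the coefficients. -/
theorem Series.hasSum_shiftX {S : Series N} {x y : ℂ} (h : (x, y) ∈ S.region) :
    HasSum ((ofCoeff fun m n => S.coeff (m + 1) n).term (x, y)) (deriv (fun z => S (z, y)) x) := by
  have hs := S.hasSum_deriv_comp (γ := fun z => (z, y)) (.of_forall fun w => by fun_prop) h
  have hd : ∀ k : ℕ × ℕ, deriv (fun w => S.term (w, y) k) x
      = ((k.1 : ℂ) * x ^ (k.1 - 1) * y ^ k.2 / (k.1.factorial * k.2.factorial : ℂ)) •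
        S.coeff k.1 k.2 := fun k => by
    exact ((((hasDerivAt_pow k.1 x).mul_const (y ^ k.2)).div_const _).smul_const _).deriv
  simp only [hd] at hs
  -- Reindexing by `m ↦ m + 1` loses only the terms with `m = 0`, whose derivative vanishes.
  have hinj : Function.Injective fun k : ℕ × ℕ => (k.1 + 1, k.2) := fun k l hkl => by
    simp only [Prod.mk.injEq, add_left_inj] at hkl
    exact Prod.ext hkl.1 hkl.2
  rw [← hinj.hasSum_iff] at hs
  · refine (congrArg (HasSum · _) (funext fun k => ?_)).mpr hs
    simp only [Series.term, ofCoeff, Function.comp_apply, Nat.add_sub_cancel, Nat.factorial_succ]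
    congr 1
    have : ((k.1 : ℂ) + 1) ≠ 0 := by exact_mod_cast k.1.succ_ne_zero
    have : (k.1.factorial : ℂ) ≠ 0 := by exact_mod_cast k.1.factorial_ne_zero
    have : (k.2.factorial : ℂ) ≠ 0 := by exact_mod_cast k.2.factorial_ne_zero
    push_cast
    field_simp
  · rintro ⟨m, n⟩ hk
    cases m with
    | zero => simp
    | succ m => exact absurd ⟨(m, n), rfl⟩ hk

/-- The series with the roles of the two variables exchanged. -/
def Series.swap (S : Series N) : Series N := ⟨fun m n => S.coeff n m, S.regular⟩

theorem Series.term_swap (S : Series N) (p : ℂ × ℂ) :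
    S.swap.term p.swap = S.term p ∘ Prod.swap := by
  funext k
  simp only [Series.term, Series.swap, Function.comp_apply, Prod.fst_swap, Prod.snd_swap]
  rw [mul_comm (p.2 ^ k.1), mul_comm (k.1.factorial : ℂ)]

theorem Series.summable_term_swap (S : Series N) (p : ℂ × ℂ) :
    (Summable fun k => ‖S.swap.term p.swap k‖) ↔ Summable fun k => ‖S.term p k‖ := by
  rw [S.term_swap p]
  exact (Equiv.prodComm ℕ ℕ).summable_iff (f := fun k => ‖S.term p k‖)

theorem Series.eval_swap (S : Series N) (p : ℂ × ℂ) : S.swap p.swap = S p := by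
  unfold Series.eval
  rw [S.term_swap p]
  exact (Equiv.prodComm ℕ ℕ).tsum_eq (S.term p)

theorem Series.mem_region_swap (S : Series N) (p : ℂ × ℂ) :
    p.swap ∈ S.swap.region ↔ p ∈ S.region := by
  have h : Homeomorph.prodComm ℂ ℂ ⁻¹' S.swap.region = S.region :=
    ((Homeomorph.prodComm ℂ ℂ).preimage_interior _).trans
      (congrArg interior (Set.ext S.summable_term_swap))
  exact Set.ext_iff.1 h p

theorem Series.region_subset_shiftX (S : Series N) (r : ℕ) :
    S.region ⊆ (ofCoeff fun m n => S.coeff (m + r) n).region := by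
  induction r with
  | zero => exact subset_rfl
  | succ r ih =>
    refine ih.trans ?_
    refine (Series.subset_region fun p hp => (Series.hasSum_shiftX hp).summable).trans_eq ?_
    simp only [ofCoeff, add_right_comm, add_assoc]

theorem Series.iterate_deriv (S : Series N) (r : ℕ) {x y : ℂ} (h : (x, y) ∈ S.region) :
    deriv^[r] (fun z => S (z, y)) x = (ofCoeff fun m n => S.coeff (m + r) n) (x, y) := by
  induction r generalizing x with
  | zero => rfl
  | succ r ih =>
    rw [Function.iterate_succ_apply']
    -- To differentiate once more, the induction hypothesis is needed on a neighbourhood of `x`;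
    -- openness of the region provides it.
    have hev : deriv^[r] (fun z => S (z, y)) =ᶠ[nhds x]
        fun z => (ofCoeff fun m n => S.coeff (m + r) n) (z, y) := by
      have hc : ContinuousAt (fun z : ℂ => (z, y)) x := by fun_prop
      filter_upwards [hc.eventually_mem (S.isOpen_region.mem_nhds h)] with z hz using ih hz
    rw [hev.deriv_eq, ← (Series.hasSum_shiftX (S.region_subset_shiftX r h)).tsum_eq]
    simp only [ofCoeff, add_right_comm, add_assoc, Series.eval]

/-- Convergence of `T` is a separate hypothesis: `L` and `R` may be singular, so it does not follow
from that of `S`. -/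
theorem Series.eval_eq_mul {S T : Series N} {L R : Mat N} {p : ℂ × ℂ} (h : p ∈ T.region)
    (hc : ∀ m n, S.coeff m n = L * T.coeff m n * R) : S p = L * T p * R := by
  have : S.term p = fun k => L * T.term p k * R := by
    funext k
    simp only [Series.term, hc, mul_smul_comm, smul_mul_assoc]
  unfold Series.eval
  rw [this, Summable.tsum_mul_right _ ((T.summable_term h).mul_left L),
    Summable.tsum_mul_left _ (T.summable_term h)]

theorem DiffX.of_coeff {r : ℕ} {S T : Series N} {L R : Mat N}
    (h : S.regular → T.regular → ∀ m n, S.coeff (m + r) n = L * T.coeff m n * R) :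
    DiffX r S L T R := fun x y ⟨hS, hT⟩ =>
  ⟨S.analyticAt_comp (γ := fun z => (z, y)) (.of_forall fun w => by fun_prop) hS.2,
    (S.iterate_deriv r hS.2).trans (Series.eval_eq_mul hT.2 (h hS.1 hT.1))⟩

theorem DiffX.swap {r : ℕ} {S T : Series N} {L R : Mat N} (h : DiffX r S.swap L T.swap R) :
    DiffY r S L T R := fun x y ⟨hS, hT⟩ => by
  have := h y x ⟨⟨hS.1, (S.mem_region_swap (x, y)).2 hS.2⟩, hT.1, (T.mem_region_swap (x, y)).2 hT.2⟩
  have e1 : ∀ z, S.swap (z, x) = S (x, z) := fun z => S.eval_swap (x, z)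
  have e2 : T.swap (y, x) = T (x, y) := T.eval_swap (x, y)
  simpa only [e1, e2] using this

theorem DiffY.of_coeff {r : ℕ} {S T : Series N} {L R : Mat N}
    (h : S.regular → T.regular → ∀ m n, S.coeff m (n + r) = L * T.coeff m n * R) :
    DiffY r S L T R :=
  DiffX.swap (DiffX.of_coeff fun hS hT m n => h hS hT n m)

/-! ### Derivatives along monomial curves, with a matrix power as a factor -/

theorem hasDerivAt_mpow (P : Mat N) {z : ℂ} (hz : z ∈ Complex.slitPlane) :
    HasDerivAt (fun w => mpow w P) (z⁻¹ • (P * mpow z P)) z :=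
  (hasDerivAt_exp_smul_const' (𝕂 := ℂ) P (Complex.log z)).scomp z (Complex.hasDerivAt_log hz)

/-- The scalar matrix `log z` commutes with everything, and its exponential is `z`. -/
theorem mpow_add_one (P : Mat N) {z : ℂ} (hz : z ≠ 0) : mpow z (P + 1) = z • mpow z P := by
  unfold mpow
  rw [smul_add, Matrix.exp_add_of_commute _ _
    (((Commute.one_right P).smul_right _).smul_left _)]
  have : (Complex.log z • (1 : Mat N)) = algebraMap ℂ (Mat N) (Complex.log z) := by
    rw [Algebra.algebraMap_eq_smul_one]
  rw [this, ← NormedSpace.algebraMap_exp_comm, ← Complex.exp_eq_exp_ℂ, Complex.exp_log hz,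
    Algebra.algebraMap_eq_smul_one, mul_smul_comm, mul_one]

theorem commute_mpow_right {X P : Mat N} (h : Commute X P) (z : ℂ) : Commute X (mpow z P) :=
  (h.smul_right _).exp_right

/-- The curve `z ↦ (x z ^ a, y z ^ b)`. -/
noncomputable def monomialCurve (x y : ℂ) (a b : ℤ) (z : ℂ) : ℂ × ℂ := (x * z ^ a, y * z ^ b)

theorem eventually_differentiableAt_monomialCurve (x y : ℂ) (a b : ℤ) {z : ℂ} (hz : z ≠ 0) :
    ∀ᶠ w in nhds z, DifferentiableAt ℂ (monomialCurve x y a b) w := by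
  filter_upwards [isOpen_ne.mem_nhds hz] with w hw
  exact ((differentiableAt_zpow.2 (Or.inl hw)).const_mul x).prodMk
    ((differentiableAt_zpow.2 (Or.inl hw)).const_mul y)

/-- Homogeneity along the curve: through it, `z d/dz` acts on each term as a scalar. -/
theorem Series.term_monomialCurve (S : Series N) (x y : ℂ) (a b : ℤ) {z : ℂ} (hz : z ≠ 0)
    (k : ℕ × ℕ) : S.term (monomialCurve x y a b z) k = z ^ (a * k.1 + b * k.2) • S.term (x, y) k := by
  simp only [Series.term, monomialCurve, mul_pow, zpow_add₀ hz, zpow_mul, zpow_natCast, smul_smul]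
  congr 1
  ring

/-- By homogeneity, `z d/dz` multiplies each term by its degree `a m + b n`. -/
theorem Series.hasSum_euler {S : Series N} {x y z : ℂ} {a b : ℤ} (hz : z ≠ 0)
    (h : monomialCurve x y a b z ∈ S.region) :
    HasSum ((ofCoeff fun m n => ((a * m + b * n : ℤ) : ℂ) • S.coeff m n).term
      (monomialCurve x y a b z)) (z • deriv (fun w => S (monomialCurve x y a b w)) z) := by
  have hs := (S.hasSum_deriv_comp (eventually_differentiableAt_monomialCurve x y a b hz) h).const_smul z
  refine (congrArg (HasSum · _) (funext fun k => ?_)).mpr hs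
  have hev : (fun w => S.term (monomialCurve x y a b w) k) =ᶠ[nhds z]
      fun w => w ^ (a * k.1 + b * k.2) • S.term (x, y) k := by
    filter_upwards [isOpen_ne.mem_nhds hz] with w hw using S.term_monomialCurve x y a b hw k
  rw [hev.deriv_eq, ((hasDerivAt_zpow _ z (Or.inl hz)).smul_const _).deriv,
    Series.term_monomialCurve _ _ _ _ _ hz]
  simp only [Series.term, ofCoeff, smul_smul]
  congr 1
  rw [zpow_sub_one₀ hz]
  field_simp

theorem Series.region_subset_euler (S : Series N) (a b : ℤ) :
    S.region ⊆ (ofCoeff fun m n => ((a * m + b * n : ℤ) : ℂ) • S.coeff m n).region :=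
  Series.subset_region fun p hp => by
    -- Every point lies on the monomial curve through it, at parameter `1`, so convergence along
    -- curves gives convergence at all points of the region.
    have h1 : monomialCurve p.1 p.2 a b 1 = p := by simp [monomialCurve]
    have := (Series.hasSum_euler (S := S) (x := p.1) (y := p.2) (a := a) (b := b) one_ne_zero
      (by rwa [h1])).summable
    rwa [h1] at this

/-- The series whose sum is obtained from that of `S` by the operator
`F ↦ P F + a x ∂F/∂x + b y ∂F/∂y + F Q`. -/
noncomputable def Series.euler (S : Series N) (a b : ℤ) (P Q : Mat N) : Series N :=
  ofCoeff fun m n => P * S.coeff m n + ((a * m + b * n : ℤ) : ℂ) • S.coeff m n + S.coeff m n * Q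

theorem Series.term_euler (S : Series N) (a b : ℤ) (P Q : Mat N) (p : ℂ × ℂ) (k : ℕ × ℕ) :
    (S.euler a b P Q).term p k = P * S.term p k
      + (ofCoeff fun m n => ((a * m + b * n : ℤ) : ℂ) • S.coeff m n).term p k
      + S.term p k * Q := by
  simp only [Series.term, Series.euler, ofCoeff, smul_add, mul_smul_comm, smul_mul_assoc]

theorem Series.region_subset_region_euler (S : Series N) (a b : ℤ) (P Q : Mat N) :
    S.region ⊆ (S.euler a b P Q).region :=
  Series.subset_region fun p hp => by
    have h := S.summable_term hp
    exact (((h.mul_left P).add (Series.summable_term (S.region_subset_euler a b hp))).add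
      (h.mul_right Q)).congr fun k => (S.term_euler a b P Q p k).symm

/-- The product rule, with `P` moved past `z^P` to stand next to the series. Powers on both sides
are allowed so that one computation serves both kinds of formula, the unused exponent being `0`. -/
theorem Series.hasDerivAt_mpow_mul {S : Series N} {x y z : ℂ} {a b : ℤ} (P Q : Mat N)
    (hz : z ∈ Complex.slitPlane) (h : monomialCurve x y a b z ∈ S.region) :
    HasDerivAt (fun w => mpow w P * S (monomialCurve x y a b w) * mpow w Q)
      (z⁻¹ • (mpow z P * (S.euler a b P Q) (monomialCurve x y a b z) * mpow z Q)) z := by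
  have hz0 := Complex.slitPlane_ne_zero hz
  have hS := (S.analyticAt_comp (eventually_differentiableAt_monomialCurve x y a b hz0)
    h).differentiableAt.hasDerivAt
  have he : (S.euler a b P Q) (monomialCurve x y a b z) = P * S (monomialCurve x y a b z)
      + z • deriv (fun w => S (monomialCurve x y a b w)) z + S (monomialCurve x y a b z) * Q := by
    have hs := (S.summable_term h).hasSum
    exact (((hs.mul_left P).add (Series.hasSum_euler hz0 h)).add (hs.mul_right Q)).congr_fun
      (fun k => (S.term_euler a b P Q _ k)) |>.tsum_eq
  refine (((hasDerivAt_mpow P hz).mul hS).mul (hasDerivAt_mpow Q hz)).congr_deriv ?_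
  rw [he, Pi.mul_apply, (commute_mpow_right (Commute.refl P) z).eq]
  simp only [mul_add, add_mul, smul_add, smul_mul_assoc, mul_smul_comm, smul_smul,
    inv_mul_cancel₀ hz0, one_smul, mul_assoc]

theorem Series.analyticAt_mpow_mul {S : Series N} {x y z : ℂ} {a b : ℤ} (P Q : Mat N)
    (hz : z ∈ Complex.slitPlane) (h : monomialCurve x y a b z ∈ S.region) :
    AnalyticAt ℂ (fun w => mpow w P * S (monomialCurve x y a b w) * mpow w Q) z := by
  refine DifferentiableOn.analyticAt (s := {w | w ∈ Complex.slitPlane ∧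
    monomialCurve x y a b w ∈ S.region})
    (fun w hw => (S.hasDerivAt_mpow_mul P Q hw.1 hw.2).differentiableAt.differentiableWithinAt) ?_
  have hc := (eventually_differentiableAt_monomialCurve x y a b
    (Complex.slitPlane_ne_zero hz)).self_of_nhds.continuousAt
  exact Filter.inter_mem (Complex.isOpen_slitPlane.mem_nhds hz)
    (hc.eventually_mem (S.isOpen_region.mem_nhds h))

@[simp]
theorem mpow_zero (z : ℂ) : mpow z (0 : Mat N) = 1 := by
  simp [mpow]

/-- A step common to the iterations below: the derivative of a function that agrees near `z` with
`mpow w P * S (γ w) * mpow w Q` along a monomial curve `γ`. -/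
theorem Series.deriv_eq_of_eqOn {S : Series N} {x y z : ℂ} {a b : ℤ} {P Q : Mat N} {f : ℂ → Mat N}
    {U : Set (ℂ × ℂ)} (hU : IsOpen U) (hzU : monomialCurve x y a b z ∈ U)
    (hz : z ∈ Complex.slitPlane) (h : monomialCurve x y a b z ∈ S.region)
    (hf : ∀ w ∈ Complex.slitPlane, monomialCurve x y a b w ∈ U →
      f w = mpow w P * S (monomialCurve x y a b w) * mpow w Q) :
    deriv f z = z⁻¹ • (mpow z P * (S.euler a b P Q) (monomialCurve x y a b z) * mpow z Q) := by
  have hc := (eventually_differentiableAt_monomialCurve x y a b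
    (Complex.slitPlane_ne_zero hz)).self_of_nhds.continuousAt
  have hev : f =ᶠ[nhds z] fun w => mpow w P * S (monomialCurve x y a b w) * mpow w Q := by
    filter_upwards [Complex.isOpen_slitPlane.mem_nhds hz, hc.eventually_mem (hU.mem_nhds hzU)]
      with w hw hw' using hf w hw hw'
  rw [hev.deriv_eq, (S.hasDerivAt_mpow_mul P Q hz h).deriv]

/-! ### Iterated operators on a series times a matrix power. -/

/-- The coefficients obtained from those of `S` by `r` applications of `z ^ 2 d/dz` to a function
with the factor `z ^ P` on the left. -/
noncomputable def Series.raiseLeft (S : Series N) (a b : ℤ) (P : Mat N) (r : ℕ) : Series N :=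
  ofCoeff fun m n => poch (P + ((a * m + b * n : ℤ) : Mat N)) r * S.coeff m n

/-- One more step multiplies `(P + κ)_r` by `P + r + κ`, which is precisely the last factor of `(P +
κ)_{r+1}`. -/
theorem Series.euler_raiseLeft (S : Series N) (a b : ℤ) (P : Mat N) (r : ℕ) :
    (S.raiseLeft a b P r).euler a b (P + r • 1) 0 = S.raiseLeft a b P (r + 1) := by
  unfold Series.raiseLeft Series.euler
  simp only [ofCoeff]
  congr 1
  funext m n
  rw [mul_zero, add_zero, Nat.cast_add_one, poch_natCast_add_one,
    ← (commute_poch_right ((Commute.refl (P + ((a * m + b * n : ℤ) : Mat N))).add_left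
      (Nat.cast_commute r _)) r).eq, Int.cast_smul_eq_zsmul, zsmul_eq_mul, ← mul_assoc, ← mul_assoc,
      ← add_mul, ← add_mul, nsmul_one]
  congr 2
  abel

theorem Series.region_subset_raiseLeft (S : Series N) (a b : ℤ) (P : Mat N) (r : ℕ) :
    S.region ⊆ (S.raiseLeft a b P r).region := by
  induction r with
  | zero =>
    simp [Series.raiseLeft, ofCoeff, Series.region, Series.term]
  | succ r ih =>
    rw [← S.euler_raiseLeft a b P r]
    exact ih.trans (Series.region_subset_region_euler _ a b _ _)

/-- Write `z² d/dz` as `z · (z d/dz)`: the Euler part adds a factor to the symbol, and the remaining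
`z` raises the exponent from `P + r` to `P + r + 1`. -/
theorem Series.iterate_sqDeriv_left (S : Series N) (x y : ℂ) (a b : ℤ) (P : Mat N) (r : ℕ) {z : ℂ}
    (hz : z ∈ Complex.slitPlane) (h : monomialCurve x y a b z ∈ S.region) :
    sqDeriv^[r] (fun w => mpow w P * S (monomialCurve x y a b w)) z
      = mpow z (P + r • 1) * (S.raiseLeft a b P r) (monomialCurve x y a b z) := by
  induction r generalizing z with
  | zero => simp [Series.raiseLeft, ofCoeff, Series.eval, Series.term]
  | succ r ih =>
    have hz0 := Complex.slitPlane_ne_zero hz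
    rw [Function.iterate_succ_apply']
    unfold sqDeriv at ih ⊢
    rw [Series.deriv_eq_of_eqOn (P := P + r • 1) (Q := 0) S.isOpen_region h hz (S.region_subset_raiseLeft a b P r h)
      (fun w hw hw' => by rw [ih hw hw', mpow_zero, mul_one]), S.euler_raiseLeft, mpow_zero, mul_one,
      add_smul, one_smul, ← add_assoc, mpow_add_one _ hz0, smul_smul, smul_mul_assoc]
    congr 1
    field_simp

/-- The coefficients obtained from those of `S` by `r` applications of `z ^ 2 d/dz` to a function
with the factor `z ^ P` on the right. -/
noncomputable def Series.raiseRight (S : Series N) (a b : ℤ) (P : Mat N) (r : ℕ) : Series N :=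
  ofCoeff fun m n => S.coeff m n * poch (P + ((a * m + b * n : ℤ) : Mat N)) r

theorem Series.euler_raiseRight (S : Series N) (a b : ℤ) (P : Mat N) (r : ℕ) :
    (S.raiseRight a b P r).euler a b 0 (P + r • 1) = S.raiseRight a b P (r + 1) := by
  unfold Series.raiseRight Series.euler
  simp only [ofCoeff]
  congr 1
  funext m n
  rw [zero_mul, zero_add, Nat.cast_add_one, poch_natCast_add_one, Int.cast_smul_eq_zsmul,
    zsmul_eq_mul, (Int.cast_commute _ _).eq, mul_assoc, mul_assoc, ← mul_add, ← mul_add, nsmul_one]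
  congr 2
  abel

theorem Series.region_subset_raiseRight (S : Series N) (a b : ℤ) (P : Mat N) (r : ℕ) :
    S.region ⊆ (S.raiseRight a b P r).region := by
  induction r with
  | zero =>
    simp [Series.raiseRight, ofCoeff, Series.region, Series.term]
  | succ r ih =>
    rw [← S.euler_raiseRight a b P r]
    exact ih.trans (Series.region_subset_region_euler _ a b _ _)

theorem Series.iterate_sqDeriv_right (S : Series N) (x y : ℂ) (a b : ℤ) (P : Mat N) (r : ℕ) {z : ℂ}
    (hz : z ∈ Complex.slitPlane) (h : monomialCurve x y a b z ∈ S.region) :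
    sqDeriv^[r] (fun w => S (monomialCurve x y a b w) * mpow w P) z
      = (S.raiseRight a b P r) (monomialCurve x y a b z) * mpow z (P + r • 1) := by
  induction r generalizing z with
  | zero => simp [Series.raiseRight, ofCoeff, Series.eval, Series.term]
  | succ r ih =>
    have hz0 := Complex.slitPlane_ne_zero hz
    rw [Function.iterate_succ_apply']
    unfold sqDeriv at ih ⊢
    rw [Series.deriv_eq_of_eqOn (P := 0) (Q := P + r • 1) S.isOpen_region h hz
      (S.region_subset_raiseRight a b P r h)
      (fun w hw hw' => by rw [ih hw hw', mpow_zero, one_mul]), S.euler_raiseRight, mpow_zero, one_mul,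
      add_smul, one_smul, ← add_assoc, mpow_add_one _ hz0, smul_smul, mul_smul_comm]
    congr 1
    field_simp

/-- The coefficients obtained from those of `S` by `r` derivatives of a function with the factor
`z ^ (C - I)` on the right. -/
noncomputable def Series.lowerRight (S : Series N) (a b : ℤ) (C : Mat N) (r : ℕ) : Series N :=
  ofCoeff fun m n => S.coeff m n * poch (C - r • 1 + ((a * m + b * n : ℤ) : Mat N)) r

/-- Here the exponent descends, so the new factor `C - (r + 1) + κ` is the first factor of the next
symbol rather than its last. -/
theorem Series.euler_lowerRight (S : Series N) (a b : ℤ) (C : Mat N) (r : ℕ) :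
    (S.lowerRight a b C r).euler a b 0 (C - (r + 1) • 1) = S.lowerRight a b C (r + 1) := by
  unfold Series.lowerRight Series.euler
  simp only [ofCoeff]
  congr 1
  funext m n
  -- A shift by `1` splits off the first factor of the symbol of length `r + 1`.
  have e := poch_shift (A := C - (r + 1) • 1 + ((a * m + b * n : ℤ) : Mat N)) (k := r) 1
    (Or.inl (Int.natCast_nonneg r))
  have e1 : ∀ D : Mat N, poch D (1 : ℕ) = D := fun D => by
    simpa using poch_natCast_add_one D 0
  rw [e1, show C - (r + 1) • (1 : Mat N) + ((a * m + b * n : ℤ) : Mat N) + 1 • 1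
    = C - r • 1 + ((a * m + b * n : ℤ) : Mat N) by rw [add_smul]; abel, Nat.cast_one] at e
  rw [Nat.cast_add_one, e]
  have hc : Commute (C - (r + 1) • 1 + ((a * m + b * n : ℤ) : Mat N))
      (poch (C - r • 1 + ((a * m + b * n : ℤ) : Mat N)) r) :=
    commute_poch_right (commute_add_intCast_left (commute_sub_left
      ((commute_sub_right (Commute.refl C) r).add_right (Int.commute_cast C _)) _) _) r
  rw [hc.eq, zero_mul, zero_add, Int.cast_smul_eq_zsmul,
    zsmul_eq_mul, (Int.cast_commute _ _).eq, mul_assoc, mul_assoc, ← mul_add, ← mul_add]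
  congr 2
  abel

theorem Series.region_subset_lowerRight (S : Series N) (a b : ℤ) (C : Mat N) (r : ℕ) :
    S.region ⊆ (S.lowerRight a b C r).region := by
  induction r with
  | zero =>
    simp [Series.lowerRight, ofCoeff, Series.region, Series.term]
  | succ r ih =>
    rw [← S.euler_lowerRight a b C r]
    exact ih.trans (Series.region_subset_region_euler _ a b _ _)

theorem Series.iterate_deriv_lower (S : Series N) (x y : ℂ) (a b : ℤ) (C : Mat N) (r : ℕ) {z : ℂ}
    (hz : z ∈ Complex.slitPlane) (h : monomialCurve x y a b z ∈ S.region) :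
    deriv^[r] (fun w => S (monomialCurve x y a b w) * mpow w (C - 1)) z
      = (S.lowerRight a b C r) (monomialCurve x y a b z) * mpow z (C - (r + 1) • 1) := by
  induction r generalizing z with
  | zero => simp [Series.lowerRight, ofCoeff, Series.eval, Series.term]
  | succ r ih =>
    have hz0 := Complex.slitPlane_ne_zero hz
    -- Plain `d/dz` leaves a factor `z⁻¹`; it is absorbed by lowering the exponent by one.
    have hpow : mpow z (C - (r + 1) • 1) = z • mpow z (C - (r + 1 + 1) • 1) := by
      rw [← mpow_add_one _ hz0]
      congr 1
      rw [add_smul (r + 1), one_smul]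
      abel
    rw [Function.iterate_succ_apply']
    rw [Series.deriv_eq_of_eqOn (P := 0) (Q := C - (r + 1) • 1) S.isOpen_region h hz
      (S.region_subset_lowerRight a b C r h)
      (fun w hw hw' => by rw [ih hw hw', mpow_zero, one_mul]), S.euler_lowerRight, mpow_zero,
      one_mul, hpow, mul_smul_comm, smul_smul, inv_mul_cancel₀ hz0, one_smul]

/-! ### From coefficients that differ in one factor to the power formulas. -/

/-- `Y` is obtained from `X` by replacing the factor `x` by `y`, where the factors before it commute
with `P`. -/
def ReplaceLeft (P x y X Y : Mat N) : Prop :=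
  ∃ U V, Commute P U ∧ X = U * x * V ∧ Y = U * y * V

theorem ReplaceLeft.self (P x y : Mat N) : ReplaceLeft P x y x y :=
  ⟨1, 1, Commute.one_right P, by simp, by simp⟩

theorem ReplaceLeft.left_mul {P U : Mat N} (h : Commute P U) (x y : Mat N) :
    ReplaceLeft P x y (U * x) (U * y) :=
  ⟨U, 1, h, by simp, by simp⟩

theorem ReplaceLeft.mul_right {P x y X Y : Mat N} (h : ReplaceLeft P x y X Y) (Z : Mat N) :
    ReplaceLeft P x y (X * Z) (Y * Z) := by
  obtain ⟨U, V, hU, rfl, rfl⟩ := h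
  exact ⟨U, V * Z, hU, mul_assoc _ _ _, mul_assoc _ _ _⟩

/-- `Y` is obtained from `X` by replacing the factor `x` by `y`, where the factors after it commute
with `P`. -/
def ReplaceRight (P x y X Y : Mat N) : Prop :=
  ∃ U V, Commute P V ∧ X = U * x * V ∧ Y = U * y * V

theorem ReplaceRight.left_mul (P U x y : Mat N) : ReplaceRight P x y (U * x) (U * y) :=
  ⟨U, 1, Commute.one_right P, by simp, by simp⟩

theorem ReplaceRight.self (P x y : Mat N) : ReplaceRight P x y x y :=
  ⟨1, 1, Commute.one_right P, by simp, by simp⟩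

theorem ReplaceRight.mul_right {P x y X Y Z : Mat N} (h : ReplaceRight P x y X Y)
    (hZ : Commute P Z) : ReplaceRight P x y (X * Z) (Y * Z) := by
  obtain ⟨U, V, hV, rfl, rfl⟩ := h
  exact ⟨U, V * Z, hV.mul_right hZ, mul_assoc _ _ _, mul_assoc _ _ _⟩

/-- The multiplier `(P + κ)_r` crosses `U` to reach `(P)_κ`, `poch_mul_poch` exchanges it for
`(P)_r`, and this crosses `U` back. What follows the symbol is never crossed. The hypothesis `hκ`
says that the curve fits the coefficient: the index of the symbol is the degree of the term. -/
theorem PowLeft.of_coeff {r : ℕ} {S T : Series N} {P : Mat N} {γ : ℂ → ℂ × ℂ} {x y : ℂ} {a b : ℤ}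
    {κ : ℕ → ℕ → ℤ} (hγ : γ = monomialCurve x y a b)
    (hreg : S.regular → T.regular → ∀ m n : ℕ, 0 ≤ κ m n ∨ (NegReg P ∧ NegReg (P + r • 1)))
    (hST : ∀ m n, ReplaceLeft P (poch P (κ m n)) (poch (P + r • 1) (κ m n))
      (S.coeff m n) (T.coeff m n))
    (hκ : ∀ m n : ℕ, κ m n = a * m + b * n := by intros; ring) : PowLeft r P S T γ := by
  subst hγ
  rintro z hz ⟨hzS, hzT⟩
  refine ⟨?_, ?_⟩
  · simpa using S.analyticAt_mpow_mul P 0 hz hzS.2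
  rw [S.iterate_sqDeriv_left x y a b P r hz hzS.2, Series.eval_eq_mul (T := T) (L := poch P r)
    (R := 1) hzT.2, mul_one, mul_assoc]
  intro m n
  obtain ⟨U, V, hU, hS, hT⟩ := hST m n
  have hc : Commute (poch (P + (κ m n : Mat N)) r) U :=
    commute_poch_left (commute_add_intCast_left hU _) r
  simp only [Series.raiseLeft, ofCoeff, ← hκ]
  rw [hS, hT, mul_one, ← mul_assoc, ← mul_assoc, ← mul_assoc, ← mul_assoc, hc.eq,
    (commute_poch_left hU r).eq, mul_assoc U _ (poch P _),
    mul_assoc U _ (poch (P + r • 1) _), poch_mul_poch r (hreg hzS.1 hzT.1 m n)]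

theorem PowRight.of_coeff {r : ℕ} {S T : Series N} {P : Mat N} {γ : ℂ → ℂ × ℂ} {x y : ℂ} {a b : ℤ}
    {κ : ℕ → ℕ → ℤ} (hγ : γ = monomialCurve x y a b)
    (hreg : S.regular → T.regular → ∀ m n : ℕ, 0 ≤ κ m n ∨ (NegReg P ∧ NegReg (P + r • 1)))
    (hST : ∀ m n, ReplaceRight P (poch P (κ m n)) (poch (P + r • 1) (κ m n))
      (S.coeff m n) (T.coeff m n))
    (hκ : ∀ m n : ℕ, κ m n = a * m + b * n := by intros; ring) : PowRight r P S T γ := by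
  subst hγ
  rintro z hz ⟨hzS, hzT⟩
  refine ⟨?_, ?_⟩
  · simpa using S.analyticAt_mpow_mul 0 P hz hzS.2
  -- The coefficients yield `(P)_r` next to the series; it is exchanged with the matrix power to
  -- stand last.
  have hm : Commute (poch P r) (mpow z (P + r • 1)) :=
    commute_poch_left (commute_mpow_right (commute_add_right (Commute.refl P) r) z) r
  rw [S.iterate_sqDeriv_right x y a b P r hz hzS.2, Series.eval_eq_mul (T := T) (L := 1)
    (R := poch P r) hzT.2, one_mul, mul_assoc, hm.eq, mul_assoc]
  intro m n
  obtain ⟨U, V, hV, hS, hT⟩ := hST m n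
  have hc : Commute (poch (P + (κ m n : Mat N)) r) V :=
    commute_poch_left (commute_add_intCast_left hV _) r
  have hc' : Commute (poch (P + (κ m n : Mat N)) r) (poch P (κ m n)) :=
    commute_poch_left (commute_add_intCast_left (commute_poch_right (Commute.refl P) _) _) r
  have hc'' : Commute (poch P r) (poch (P + r • 1) (κ m n)) :=
    commute_poch_left (commute_poch_right (commute_add_right (Commute.refl P) r) _) r
  simp only [Series.raiseRight, ofCoeff, ← hκ]
  rw [hS, hT, one_mul, mul_assoc _ V, mul_assoc _ V, ← hc.eq, ← (commute_poch_left hV r).eq,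
    mul_assoc U, mul_assoc U, ← mul_assoc (poch P _), ← hc'.eq,
    ← mul_assoc (poch (P + r • 1) _), ← hc''.eq, poch_mul_poch r (hreg hzS.1 hzT.1 m n)]

theorem PowLower.of_coeff {r : ℕ} {S T : Series N} {C : Mat N} {γ : ℂ → ℂ × ℂ} {x y : ℂ} {a b : ℤ}
    {κ : ℕ → ℕ → ℤ} (hγ : γ = monomialCurve x y a b)
    (hreg : S.regular → T.regular → PosReg C ∧ PosReg (C - r • 1))
    (hST : ∀ m n, ReplaceRight C (poch C (κ m n))⁻¹ (poch (C - r • 1) (κ m n))⁻¹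
      (S.coeff m n) (T.coeff m n))
    (hκ : ∀ m n : ℕ, κ m n = a * m + b * n := by intros; ring)
    (hpos : ∀ m n : ℕ, 0 ≤ κ m n := by intros; positivity) :
    PowLower r C S T γ := by
  subst hγ
  rintro z hz ⟨hzS, hzT⟩
  refine ⟨?_, ?_⟩
  · simpa using S.analyticAt_mpow_mul 0 (C - 1) hz hzS.2
  -- The constant `(-1)^r (I - C)_r` commutes with whatever commutes with `C`: the factors after the
  -- symbol, and the matrix power.
  have hcl : ∀ X : Mat N, Commute C X → Commute X ((-1) ^ r * poch (1 - C) r) := fun X hX =>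
    (commute_neg_one_pow_right X r).mul_right
      (commute_poch_right (commute_one_sub_right hX.symm) r)
  have hm := hcl (mpow z (C - (r + 1) • 1))
    (commute_mpow_right (commute_sub_right (Commute.refl C) _) z)
  rw [S.iterate_deriv_lower x y a b C r hz hzS.2, Series.eval_eq_mul (T := T) (L := 1)
    (R := (-1) ^ r * poch (1 - C) r) hzT.2, one_mul, mul_assoc, ← hm.eq,
    (commute_neg_one_pow_left (T (monomialCurve x y a b z)) r).eq, mul_assoc, mul_assoc,
    ← mul_assoc (mpow z _), (commute_neg_one_pow_right (mpow z (C - (r + 1) • 1)) r).eq, mul_assoc]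
  intro m n
  obtain ⟨U, V, hV, hS, hT⟩ := hST m n
  obtain ⟨h1, h2⟩ := hreg hzS.1 hzT.1
  have hc : Commute (poch (C - r • 1 + (κ m n : Mat N)) r) V :=
    commute_poch_left (commute_add_intCast_left (commute_sub_left hV r) _) r
  simp only [Series.lowerRight, ofCoeff, ← hκ]
  rw [hS, hT, one_mul, mul_assoc _ V, mul_assoc _ V, (hcl _ hV).eq, ← hc.eq, mul_assoc U,
    mul_assoc U, ← mul_assoc (poch C _)⁻¹, ← mul_assoc (poch (C - r • 1) _)⁻¹,
    poch_inv_mul_poch r (hpos m n) h1 h2]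

/-! ### Shifted indices in a coefficient -/

/-- In this family `j` is the index in the differentiated coefficient and `k` the one in the target.
The variants differ in the end to which the constant goes. -/
theorem poch_raise {A : Mat N} (r : ℕ) (k : ℤ) {j : ℤ}
    (h : 0 ≤ k ∨ (NegReg A ∧ NegReg (A + r • 1))) (hj : j = k + r := by omega) :
    poch A j = poch A r * poch (A + r • 1) k :=
  hj ▸ poch_shift r h

theorem poch_raise_right {A : Mat N} (r : ℕ) (k : ℤ) {j : ℤ}
    (h : 0 ≤ k ∨ (NegReg A ∧ NegReg (A + r • 1))) (hj : j = k + r := by omega) :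
    poch A j = poch (A + r • 1) k * poch A r :=
  (poch_raise r k h hj).trans
    (commute_poch_left (commute_poch_right (commute_add_right (Commute.refl A) r) _) _).eq

/-- For the indices `2m ± n`, which the shift `m ↦ m + r` moves by `2r`. -/
theorem poch_raise_two {A : Mat N} (r : ℕ) (k : ℤ) {j : ℤ}
    (h : 0 ≤ k ∨ (NegReg A ∧ NegReg (A + (2 * r) • 1))) (hj : j = k + 2 * r := by omega) :
    poch A j = poch A (2 * r) * poch (A + (2 * r) • 1) k := by
  have := poch_raise (2 * r) k h (j := j) (by push_cast; exact hj)
  rwa [Nat.cast_mul, Nat.cast_ofNat] at this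

theorem poch_raise_two_right {A : Mat N} (r : ℕ) (k : ℤ) {j : ℤ}
    (h : 0 ≤ k ∨ (NegReg A ∧ NegReg (A + (2 * r) • 1))) (hj : j = k + 2 * r := by omega) :
    poch A j = poch (A + (2 * r) • 1) k * poch A (2 * r) :=
  (poch_raise_two r k h hj).trans
    (commute_poch_left (commute_poch_right (commute_add_right (Commute.refl A) _) _) _).eq

theorem poch_lower {A : Mat N} (h : NegReg A) (r : ℕ) (k : ℤ) {j : ℤ} (hj : j = k - r := by omega) :
    poch A j = (-1) ^ r * (poch (1 - A) r)⁻¹ * poch (A - r • 1) k :=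
  hj ▸ poch_sub_natCast h k r

theorem poch_lower_right {A : Mat N} (h : NegReg A) (r : ℕ) (k : ℤ) {j : ℤ} (hj : j = k - r := by omega) :
    poch A j = poch (A - r • 1) k * ((-1) ^ r * (poch (1 - A) r)⁻¹) :=
  (poch_lower h r k hj).trans ((commute_neg_one_pow_left _ r).mul_left (commute_inv_left
    (commute_poch_left (commute_one_sub_left (commute_poch_right
      (commute_sub_right (Commute.refl A) r) _)) _))).eq

/-- Inversion reverses the product, so the constant lands on the right. No invertibility is needed,
since `(XY)⁻¹ = Y⁻¹X⁻¹` holds for singular matrices too. -/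
theorem poch_inv_raise {C : Mat N} (r : ℕ) {k : ℤ} {j : ℤ} (hk : 0 ≤ k := by positivity)
    (hj : j = k + r := by omega) :
    (poch C j)⁻¹ = (poch (C + r • 1) k)⁻¹ * (poch C r)⁻¹ := by
  rw [poch_raise r k (Or.inl hk) hj, Matrix.mul_inv_rev]

/-- With the four rules that follow, this assembles a coefficient identity from left to right, one
factor at a time. The commutation hypotheses record the crossings: a new left constant crosses the
product so far, and accumulated right constants cross each new factor. -/
theorem mul_eq_of_left {X X' Y Y' L L' : Mat N} (h : X = L * Y) (h' : X' = L' * Y')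
    (hc : Commute Y L') : X * X' = L * L' * (Y * Y') := by
  rw [h, h', mul_assoc, ← mul_assoc Y, hc.eq]
  simp only [mul_assoc]

theorem mul_eq_of_left_self {X Y L : Mat N} (h : X = L * Y) (Z : Mat N) :
    X * Z = L * (Y * Z) := by
  rw [h, mul_assoc]

theorem mul_eq_of_left_right {X X' Y Y' L R : Mat N} (h : X = L * Y) (h' : X' = Y' * R) :
    X * X' = L * (Y * Y') * R := by
  rw [h, h']
  simp only [mul_assoc]

theorem mul_eq_of_right {X X' Y Y' L R R' : Mat N} (h : X = L * Y * R) (h' : X' = Y' * R')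
    (hc : Commute R Y') : X * X' = L * (Y * Y') * (R * R') := by
  rw [h, h', mul_assoc, ← mul_assoc R, hc.eq]
  simp only [mul_assoc]

theorem mul_eq_of_right_self {X Y Z L R : Mat N} (h : X = L * Y * R) (hc : Commute R Z) :
    X * Z = L * (Y * Z) * R := by
  rw [h, mul_assoc, hc.eq]
  simp only [mul_assoc]

/-- As an integer scalar, the sign can be pulled out of any place in a product by simplification. -/
theorem neg_one_pow_mul_eq_smul (r : ℕ) (X : Mat N) : (-1) ^ r * X = ((-1 : ℤ) ^ r) • X := by
  rw [zsmul_eq_mul]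
  simp

/-! ### Monomial curves -/

theorem monomialCurve_fst (y : ℂ) : (fun x : ℂ => (x, y)) = monomialCurve 1 y 1 0 := by
  funext x; simp [monomialCurve]

theorem monomialCurve_snd (x : ℂ) : (fun y : ℂ => (x, y)) = monomialCurve x 1 0 1 := by
  funext y; simp [monomialCurve]

theorem monomialCurve_div (y : ℂ) : (fun x : ℂ => (x, y / x)) = monomialCurve 1 y 1 (-1) := by
  funext x; simp [monomialCurve, div_eq_mul_inv]

theorem monomialCurve_div_fst (x : ℂ) : (fun y : ℂ => (x / y, y)) = monomialCurve x 1 (-1) 1 := by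
  funext y; simp [monomialCurve, div_eq_mul_inv]

theorem monomialCurve_mul (y : ℂ) : (fun x : ℂ => (x, y * x)) = monomialCurve 1 y 1 1 := by
  funext x; simp [monomialCurve]

theorem monomialCurve_mul' (y : ℂ) : (fun x : ℂ => (x, x * y)) = monomialCurve 1 y 1 1 := by
  funext x; simp [monomialCurve, mul_comm]

theorem monomialCurve_sq_mul (y : ℂ) : (fun x : ℂ => (x ^ 2, y * x)) = monomialCurve 1 y 2 1 := by
  funext x; simp [monomialCurve]

theorem monomialCurve_sq_div (y : ℂ) :
    (fun x : ℂ => (x ^ 2, y / x)) = monomialCurve 1 y 2 (-1) := by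
  funext x; simp [monomialCurve, div_eq_mul_inv]

theorem monomialCurve_div_sq (x : ℂ) :
    (fun y : ℂ => (x / y, y ^ 2)) = monomialCurve x 1 (-1) 2 := by
  funext y; simp [monomialCurve, div_eq_mul_inv]

end HornMatrix

/-! ### The formulas, function by function. -/

theorem mainTheorem8 {N : ℕ} (r : ℕ) (A A' B B' C C' C'' : Mat N) (x y : ℂ) :
    -- Horn function `G₂`
    ((Commute B B' → DiffX r (G2 A A' B B') ((-1) ^ r * poch A r)
        (G2 (A + r • 1) A' (B - r • 1) (B' + r • 1)) ((poch (1 - B) r)⁻¹ * poch B' r)) ∧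
      (Commute A A' → Commute B B' → DiffY r (G2 A A' B B') ((-1) ^ r * poch A' r)
        (G2 A (A' + r • 1) (B + r • 1) (B' - r • 1)) (poch B r * (poch (1 - B') r)⁻¹)) ∧
      (PowLeft r A (G2 A A' B B') (G2 (A + r • 1) A' B B') fun x => (x, y)) ∧
      (Commute A A' → PowLeft r A' (G2 A A' B B') (G2 A (A' + r • 1) B B') fun y => (x, y)) ∧
      (PowRight r B' (G2 A A' B B') (G2 A A' B (B' + r • 1)) fun x => (x, y / x)) ∧
      (Commute B B' → PowRight r B (G2 A A' B B') (G2 A A' (B + r • 1) B') fun y => (x / y, y))) ∧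
    -- Horn function `G₃`
    ((DiffX r (G3 A A') ((-1) ^ r * (poch (1 - A) r)⁻¹)
        (G3 (A - r • 1) (A' + (2 * r) • 1)) (poch A' (2 * r))) ∧
      (DiffY r (G3 A A') ((-1) ^ r * poch A (2 * r))
        (G3 (A + (2 * r) • 1) (A' - r • 1)) (poch (1 - A') r)⁻¹) ∧
      (PowRight r A' (G3 A A') (G3 A (A' + r • 1)) fun x => (x ^ 2, y / x)) ∧
      (PowLeft r A (G3 A A') (G3 (A + r • 1) A') fun y => (x / y, y ^ 2))) ∧
    -- Horn function `H₁`
    ((Commute A B → DiffX r (H1 A B C C') (poch A r * poch B r)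
        (H1 (A + r • 1) (B + r • 1) C (C' + r • 1)) (poch C' r)⁻¹) ∧
      (Commute A B → Commute C C' → DiffY r (H1 A B C C') ((-1) ^ r * (poch (1 - A) r)⁻¹ * poch B r)
        (H1 (A - r • 1) (B + r • 1) (C + r • 1) C') (poch C r)) ∧
      (PowLeft r A (H1 A B C C') (H1 (A + r • 1) B C C') fun x => (x, y / x)) ∧
      (Commute A B → PowLeft r B (H1 A B C C') (H1 A (B + r • 1) C C') fun x => (x, y * x)) ∧
      (Commute C C' → PowRight r C (H1 A B C C') (H1 A B (C + r • 1) C') fun y => (x, y)) ∧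
      (PowLower r C' (H1 A B C C') (H1 A B C (C' - r • 1)) fun x => (x, y))) ∧
    -- Horn function `H₂`
    ((Commute A B → DiffX r (H2 A B C C' C'') (poch A r * poch B r)
        (H2 (A + r • 1) (B + r • 1) C C' (C'' + r • 1)) (poch C'' r)⁻¹) ∧
      (Commute C C' → Commute C C'' → Commute C' C'' → DiffY r (H2 A B C C' C'') ((-1) ^ r * (poch (1 - A) r)⁻¹)
        (H2 (A - r • 1) B (C + r • 1) (C' + r • 1) C'') (poch C r * poch C' r)) ∧
      (PowLeft r A (H2 A B C C' C'') (H2 (A + r • 1) B C C' C'') fun x => (x, y / x)) ∧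
      (Commute A B → PowLeft r B (H2 A B C C' C'') (H2 A (B + r • 1) C C' C'') fun x => (x, y)) ∧
      (Commute C C' → Commute C C'' → PowRight r C (H2 A B C C' C'')
        (H2 A B (C + r • 1) C' C'') fun y => (x, y)) ∧
      (PowLower r C'' (H2 A B C C' C'') (H2 A B C C' (C'' - r • 1)) fun x => (x, y))) ∧
    -- Horn function `H₃`
    ((DiffX r (H3 A B C) (poch A (2 * r)) (H3 (A + (2 * r) • 1) B (C + r • 1)) (poch C r)⁻¹) ∧
      (Commute B C → DiffY r (H3 A B C) (poch A r)
        (H3 (A + r • 1) (B + r • 1) (C + r • 1)) (poch B r * (poch C r)⁻¹)) ∧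
      (PowLeft r A (H3 A B C) (H3 (A + r • 1) B C) fun x => (x ^ 2, y * x)) ∧
      (Commute B C → PowRight r B (H3 A B C) (H3 A (B + r • 1) C) fun y => (x, y)) ∧
      (PowLower r C (H3 A B C) (H3 A B (C - r • 1)) fun x => (x, x * y))) ∧
    -- Horn function `H₄`
    ((Commute C C' → DiffX r (H4 A B C C') (poch A (2 * r))
        (H4 (A + (2 * r) • 1) B (C + r • 1) C') (poch C r)⁻¹) ∧
      (Commute A B → DiffY r (H4 A B C C') (poch A r * poch B r)
        (H4 (A + r • 1) (B + r • 1) C (C' + r • 1)) (poch C' r)⁻¹) ∧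
      (PowLeft r A (H4 A B C C') (H4 (A + r • 1) B C C') fun x => (x ^ 2, y * x)) ∧
      (Commute A B → PowLeft r B (H4 A B C C') (H4 A (B + r • 1) C C') fun y => (x, y)) ∧
      (Commute C C' → PowLower r C (H4 A B C C') (H4 A B (C - r • 1) C') fun x => (x, y)) ∧
      (PowLower r C' (H4 A B C C') (H4 A B C (C' - r • 1)) fun y => (x, y))) ∧
    -- Horn function `H₅`
    ((Commute A B → DiffX r (H5 A B C) ((-1) ^ r * poch A (2 * r) * (poch (1 - B) r)⁻¹)
        (H5 (A + (2 * r) • 1) (B - r • 1) C) 1) ∧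
      (Commute A B → DiffY r (H5 A B C) (poch A r * poch B r)
        (H5 (A + r • 1) (B + r • 1) (C + r • 1)) (poch C r)⁻¹) ∧
      (PowLeft r A (H5 A B C) (H5 (A + r • 1) B C) fun x => (x ^ 2, y * x)) ∧
      (Commute A B → PowLeft r B (H5 A B C) (H5 A (B + r • 1) C) fun y => (x / y, y)) ∧
      (PowLower r C (H5 A B C) (H5 A B (C - r • 1)) fun y => (x, y))) ∧
    -- Horn function `H₆`
    ((Commute A B → DiffX r (H6 A B C) ((-1) ^ r * poch A (2 * r) * (poch (1 - B) r)⁻¹)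
        (H6 (A + (2 * r) • 1) (B - r • 1) C) 1) ∧
      (Commute A B → DiffY r (H6 A B C) ((-1) ^ r * (poch (1 - A) r)⁻¹ * poch B r)
        (H6 (A - r • 1) (B + r • 1) (C + r • 1)) (poch C r)) ∧
      (PowLeft r A (H6 A B C) (H6 (A + r • 1) B C) fun x => (x ^ 2, y / x)) ∧
      (Commute A B → PowLeft r B (H6 A B C) (H6 A (B + r • 1) C) fun y => (x / y, y)) ∧
      (PowRight r C (H6 A B C) (H6 A B (C + r • 1)) fun y => (x, y))) ∧
    -- Horn function `H₇`
    ((DiffX r (H7 A B C C') (poch A (2 * r))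
        (H7 (A + (2 * r) • 1) B C (C' + r • 1)) (poch C' r)⁻¹) ∧
      (Commute A B → Commute C C' → DiffY r (H7 A B C C') ((-1) ^ r * (poch (1 - A) r)⁻¹ * poch B r)
        (H7 (A - r • 1) (B + r • 1) (C + r • 1) C') (poch C r)) ∧
      (PowLeft r A (H7 A B C C') (H7 (A + r • 1) B C C') fun x => (x ^ 2, y / x)) ∧
      (Commute A B → PowLeft r B (H7 A B C C') (H7 A (B + r • 1) C C') fun y => (x, y)) ∧
      (Commute C C' → PowRight r C (H7 A B C C') (H7 A B (C + r • 1) C') fun y => (x, y)) ∧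
      (PowLower r C' (H7 A B C C') (H7 A B C (C' - r • 1)) fun x => (x, y))) ∧
    -- confluent function `Γ₁`
    ((Commute B B' → DiffX r (Γ1 A B B') ((-1) ^ r * poch A r)
        (Γ1 (A + r • 1) (B - r • 1) (B' + r • 1)) ((poch (1 - B) r)⁻¹ * poch B' r)) ∧
      (Commute B B' → DiffY r (Γ1 A B B') ((-1) ^ r)
        (Γ1 A (B + r • 1) (B' - r • 1)) (poch B r * (poch (1 - B') r)⁻¹)) ∧
      (PowLeft r A (Γ1 A B B') (Γ1 (A + r • 1) B B') fun x => (x, y)) ∧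
      (PowRight r B' (Γ1 A B B') (Γ1 A B (B' + r • 1)) fun x => (x, y / x)) ∧
      (Commute B B' → PowRight r B (Γ1 A B B') (Γ1 A (B + r • 1) B') fun y => (x / y, y))) ∧
    -- confluent function `Γ₂`
    ((DiffX r (Γ2 B B') ((-1) ^ r * (poch (1 - B) r)⁻¹)
        (Γ2 (B - r • 1) (B' + r • 1)) (poch B' r)) ∧
      (DiffY r (Γ2 B B') ((-1) ^ r * poch B r) (Γ2 (B + r • 1) (B' - r • 1)) (poch (1 - B') r)⁻¹) ∧
      (PowRight r B' (Γ2 B B') (Γ2 B (B' + r • 1)) fun x => (x, y / x)) ∧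
      (PowLeft r B (Γ2 B B') (Γ2 (B + r • 1) B') fun y => (x / y, y)) ∧
      (Commute B B' → PowRight r B (Γ2 B B') (Γ2 (B + r • 1) B') fun y => (x / y, y))) ∧
    -- confluent function `ℋ₁`
    ((Commute A B → DiffX r (ℋ1 A B C) (poch A r * poch B r)
        (ℋ1 (A + r • 1) (B + r • 1) (C + r • 1)) (poch C r)⁻¹) ∧
      (Commute A B → DiffY r (ℋ1 A B C) ((-1) ^ r * (poch (1 - A) r)⁻¹ * poch B r)
        (ℋ1 (A - r • 1) (B + r • 1) C) 1) ∧
      (PowLeft r A (ℋ1 A B C) (ℋ1 (A + r • 1) B C) fun x => (x, y / x)) ∧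
      (Commute A B → PowLeft r B (ℋ1 A B C) (ℋ1 A (B + r • 1) C) fun x => (x, y * x)) ∧
      (PowLower r C (ℋ1 A B C) (ℋ1 A B (C - r • 1)) fun x => (x, y))) ∧
    -- confluent function `ℋ₂`
    ((Commute A B → DiffX r (ℋ2 A B B' C) (poch A r * poch B r)
        (ℋ2 (A + r • 1) (B + r • 1) B' (C + r • 1)) (poch C r)⁻¹) ∧
      (Commute B' C → DiffY r (ℋ2 A B B' C) ((-1) ^ r * (poch (1 - A) r)⁻¹)
        (ℋ2 (A - r • 1) B (B' + r • 1) C) (poch B' r)) ∧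
      (PowLeft r A (ℋ2 A B B' C) (ℋ2 (A + r • 1) B B' C) fun x => (x, y / x)) ∧
      (Commute A B → PowLeft r B (ℋ2 A B B' C) (ℋ2 A (B + r • 1) B' C) fun x => (x, y)) ∧
      (Commute B' C → PowRight r B' (ℋ2 A B B' C) (ℋ2 A B (B' + r • 1) C) fun y => (x, y)) ∧
      (PowLower r C (ℋ2 A B B' C) (ℋ2 A B B' (C - r • 1)) fun x => (x, y))) ∧
    -- confluent function `ℋ₃`
    ((Commute B C → DiffX r (ℋ3 A B C) (poch A r)
        (ℋ3 (A + r • 1) (B + r • 1) (C + r • 1)) (poch B r * (poch C r)⁻¹)) ∧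
      (DiffY r (ℋ3 A B C) ((-1) ^ r * (poch (1 - A) r)⁻¹) (ℋ3 (A - r • 1) B C) 1) ∧
      (PowLeft r A (ℋ3 A B C) (ℋ3 (A + r • 1) B C) fun x => (x, y / x)) ∧
      (Commute B C → PowRight r B (ℋ3 A B C) (ℋ3 A (B + r • 1) C) fun x => (x, y)) ∧
      (PowLower r C (ℋ3 A B C) (ℋ3 A B (C - r • 1)) fun x => (x, y))) ∧
    -- confluent function `ℋ₄`
    ((DiffX r (ℋ4 A B' C) (poch A r) (ℋ4 (A + r • 1) B' (C + r • 1)) (poch C r)⁻¹) ∧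
      (Commute B' C → DiffY r (ℋ4 A B' C) ((-1) ^ r * (poch (1 - A) r)⁻¹)
        (ℋ4 (A - r • 1) (B' + r • 1) C) (poch B' r)) ∧
      (PowLeft r A (ℋ4 A B' C) (ℋ4 (A + r • 1) B' C) fun x => (x, y / x)) ∧
      (Commute B' C → PowRight r B' (ℋ4 A B' C) (ℋ4 A (B' + r • 1) C) fun y => (x, y)) ∧
      (PowLower r C (ℋ4 A B' C) (ℋ4 A B' (C - r • 1)) fun x => (x, y))) ∧
    -- confluent function `ℋ₅`
    ((DiffX r (ℋ5 A C) (poch A r) (ℋ5 (A + r • 1) (C + r • 1)) (poch C r)⁻¹) ∧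
      (DiffY r (ℋ5 A C) ((-1) ^ r * (poch (1 - A) r)⁻¹) (ℋ5 (A - r • 1) C) 1) ∧
      (PowLeft r A (ℋ5 A C) (ℋ5 (A + r • 1) C) fun x => (x, y / x)) ∧
      (PowLower r C (ℋ5 A C) (ℋ5 A (C - r • 1)) fun x => (x, y))) ∧
    -- confluent function `ℋ₆`
    ((DiffX r (ℋ6 A C) (poch A (2 * r)) (ℋ6 (A + (2 * r) • 1) (C + r • 1)) (poch C r)⁻¹) ∧
      (DiffY r (ℋ6 A C) (poch A r) (ℋ6 (A + r • 1) (C + r • 1)) (poch C r)⁻¹) ∧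
      (PowLeft r A (ℋ6 A C) (ℋ6 (A + r • 1) C) fun x => (x ^ 2, y * x)) ∧
      (PowLower r C (ℋ6 A C) (ℋ6 A (C - r • 1)) fun x => (x, x * y))) ∧
    -- confluent function `ℋ₇`
    ((Commute C C' → DiffX r (ℋ7 A C C') (poch A (2 * r))
        (ℋ7 (A + (2 * r) • 1) (C + r • 1) C') (poch C r)⁻¹) ∧
      (DiffY r (ℋ7 A C C') (poch A r) (ℋ7 (A + r • 1) C (C' + r • 1)) (poch C' r)⁻¹) ∧
      (PowLeft r A (ℋ7 A C C') (ℋ7 (A + r • 1) C C') fun x => (x ^ 2, y * x)) ∧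
      (Commute C C' → PowLower r C (ℋ7 A C C') (ℋ7 A (C - r • 1) C') fun x => (x, y)) ∧
      (PowLower r C' (ℋ7 A C C') (ℋ7 A C (C' - r • 1)) fun y => (x, y))) ∧
    -- confluent function `ℋ₈`
    ((DiffX r (ℋ8 A B) ((-1) ^ r * poch A (2 * r))
        (ℋ8 (A + (2 * r) • 1) (B - r • 1)) (poch (1 - B) r)⁻¹) ∧
      (DiffY r (ℋ8 A B) ((-1) ^ r * (poch (1 - A) r)⁻¹) (ℋ8 (A - r • 1) (B + r • 1)) (poch B r)) ∧
      (PowLeft r A (ℋ8 A B) (ℋ8 (A + r • 1) B) fun x => (x ^ 2, y / x)) ∧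
      (PowRight r B (ℋ8 A B) (ℋ8 A (B + r • 1)) fun y => (x / y, y))) ∧
    -- confluent function `ℋ₉`
    ((DiffX r (ℋ9 A B C) (poch A (2 * r)) (ℋ9 (A + (2 * r) • 1) B (C + r • 1)) (poch C r)⁻¹) ∧
      (Commute B C → DiffY r (ℋ9 A B C) ((-1) ^ r * (poch (1 - A) r)⁻¹)
        (ℋ9 (A - r • 1) (B + r • 1) C) (poch B r)) ∧
      (PowLeft r A (ℋ9 A B C) (ℋ9 (A + r • 1) B C) fun x => (x ^ 2, y / x)) ∧
      (Commute B C → PowRight r B (ℋ9 A B C) (ℋ9 A (B + r • 1) C) fun y => (x, y)) ∧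
      (PowLower r C (ℋ9 A B C) (ℋ9 A B (C - r • 1)) fun x => (x, y))) ∧
    -- confluent function `ℋ₁₀`
    ((DiffX r (ℋ10 A C) (poch A (2 * r)) (ℋ10 (A + (2 * r) • 1) (C + r • 1)) (poch C r)⁻¹) ∧
      (DiffY r (ℋ10 A C) ((-1) ^ r * (poch (1 - A) r)⁻¹) (ℋ10 (A - r • 1) C) 1) ∧
      (PowLeft r A (ℋ10 A C) (ℋ10 (A + r • 1) C) fun x => (x ^ 2, y / x)) ∧
      (PowLower r C (ℋ10 A C) (ℋ10 A (C - r • 1)) fun x => (x, y))) ∧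
    -- confluent function `ℋ₁₁`
    ((DiffX r (ℋ11 A B C C') (poch A r) (ℋ11 (A + r • 1) B C (C' + r • 1)) (poch C' r)⁻¹) ∧
      (Commute A B → Commute C C' → DiffY r (ℋ11 A B C C') ((-1) ^ r * (poch (1 - A) r)⁻¹ * poch B r)
        (ℋ11 (A - r • 1) (B + r • 1) (C + r • 1) C') (poch C r)) ∧
      (PowLeft r A (ℋ11 A B C C') (ℋ11 (A + r • 1) B C C') fun x => (x, y / x)) ∧
      (Commute A B → PowLeft r B (ℋ11 A B C C') (ℋ11 A (B + r • 1) C C') fun y => (x, y)) ∧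
      (PowLower r C' (ℋ11 A B C C') (ℋ11 A B C (C' - r • 1)) fun x => (x, y))) := by
  -- Each goal is closed by the matching `of_coeff`. In the derivative formulas the nested term
  -- follows the coefficient from left to right, and the final `simp only` reassociates and collects
  -- signs.
  refine ⟨⟨?_, ?_, ?_, ?_, ?_, ?_⟩, ⟨?_, ?_, ?_, ?_⟩, ⟨?_, ?_, ?_, ?_, ?_, ?_⟩, ⟨?_, ?_, ?_, ?_,
    ?_, ?_⟩, ⟨?_, ?_, ?_, ?_, ?_⟩, ⟨?_, ?_, ?_, ?_, ?_, ?_⟩, ⟨?_, ?_, ?_, ?_, ?_⟩, ⟨?_, ?_, ?_, ?_,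
    ?_⟩, ⟨?_, ?_, ?_, ?_, ?_, ?_⟩, ⟨?_, ?_, ?_, ?_, ?_⟩, ⟨?_, ?_, ?_, ?_, ?_⟩, ⟨?_, ?_, ?_, ?_,
    ?_⟩, ⟨?_, ?_, ?_, ?_, ?_, ?_⟩, ⟨?_, ?_, ?_, ?_, ?_⟩, ⟨?_, ?_, ?_, ?_, ?_⟩, ⟨?_, ?_, ?_, ?_⟩,
    ⟨?_, ?_, ?_, ?_⟩, ⟨?_, ?_, ?_, ?_, ?_⟩, ⟨?_, ?_, ?_, ?_⟩, ⟨?_, ?_, ?_, ?_, ?_⟩, ⟨?_, ?_, ?_,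
    ?_⟩, ⟨?_, ?_, ?_, ?_, ?_⟩⟩
  -- The constant of `B` goes to the right and must cross the symbol of `B'`; hence the hypothesis
  -- on `B` and `B'`.
  · exact fun h => .of_coeff fun ⟨hB, hB'⟩ ⟨_, kB'⟩ m n => (mul_eq_of_right (mul_eq_of_left_right
      (mul_eq_of_left_self (poch_raise r m (.inl (by positivity))) _) (poch_lower_right hB r (n -
      m))) (poch_raise_right r (m - n) (.inr ⟨hB', kB'⟩)) ((commute_neg_one_pow_left _ _).mul_left
      (commute_inv_left (commute_poch_left (commute_one_sub_left (commute_poch_right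
      (commute_add_right h _) _)) _)))).trans (by
      simp only [G2, neg_one_pow_mul_eq_smul, smul_mul_assoc, mul_smul_comm, mul_assoc])
  -- The symbol of `A` is unchanged, so it enters with left constant `1`; `(A')_r` has to cross it,
  -- which uses `h₁`.
  · exact fun h₁ h₂ => .of_coeff fun ⟨hB, hB'⟩ ⟨kB, _⟩ m n => (mul_eq_of_right
      (mul_eq_of_left_right (mul_eq_of_left ((one_mul _).symm) (poch_raise r n (.inl (by
      positivity))) (commute_poch_left (commute_poch_right h₁ _) _)) (poch_raise_right r (n - m)
      (.inr ⟨hB, kB⟩))) (poch_lower_right hB' r (m - n)) (commute_poch_left (commute_poch_right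
      (commute_sub_right h₂ _) _) _)).trans (by
      simp only [G2, neg_one_pow_mul_eq_smul, smul_mul_assoc, mul_smul_comm, mul_assoc, one_mul])
  · exact .of_coeff (monomialCurve_fst y) (fun _ _ _ _ => .inl (by positivity))
      (fun _ _ => (((ReplaceLeft.self _ _ _).mul_right _).mul_right _).mul_right _)
  · exact fun h => .of_coeff (monomialCurve_snd x) (fun _ _ _ _ => .inl (by positivity))
      (fun _ _ => ((ReplaceLeft.left_mul (commute_poch_right h.symm _) _ _).mul_right _).mul_right
        _)
  · exact .of_coeff (monomialCurve_div y) (fun ⟨_, hP⟩ ⟨_, kP⟩ _ _ => .inr ⟨hP, kP⟩)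
      (fun _ _ => ReplaceRight.left_mul _ _ _ _)
  · exact fun h => .of_coeff (monomialCurve_div_fst x) (fun ⟨hP, _⟩ ⟨kP, _⟩ _ _ => .inr ⟨hP, kP⟩)
      (fun _ _ => (ReplaceRight.left_mul _ _ _ _).mul_right (commute_poch_right h _))
  -- With two symbols only, the constants leave at opposite ends and nothing has to commute.
  · exact .of_coeff fun ⟨hA, hA'⟩ ⟨_, kA'⟩ m n => (mul_eq_of_left_right (poch_lower hA r (2 * n -
      m)) (poch_raise_two_right r (2 * m - n) (.inr ⟨hA', kA'⟩))).trans (by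
      simp only [G3, neg_one_pow_mul_eq_smul, smul_mul_assoc, mul_assoc])
  · exact .of_coeff fun ⟨hA, hA'⟩ ⟨kA, _⟩ m n => (mul_eq_of_left_right (poch_raise_two r (2 * n -
      m) (.inr ⟨hA, kA⟩)) (poch_lower_right hA' r (2 * m - n))).trans (by
      simp only [G3, neg_one_pow_mul_eq_smul, smul_mul_assoc, mul_smul_comm, mul_assoc])
  · exact .of_coeff (monomialCurve_sq_div y) (fun ⟨_, hP⟩ ⟨_, kP⟩ _ _ => .inr ⟨hP, kP⟩)
      (fun _ _ => ReplaceRight.left_mul _ _ _ _)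
  · exact .of_coeff (monomialCurve_div_sq x) (fun ⟨hP, _⟩ ⟨kP, _⟩ _ _ => .inr ⟨hP, kP⟩)
      (fun _ _ => (ReplaceLeft.self _ _ _).mul_right _)
  · exact fun h => .of_coeff fun ⟨hA, _⟩ ⟨kA, _⟩ m n => (mul_eq_of_left_right (mul_eq_of_left_self
      (mul_eq_of_left (poch_raise r (m - n) (.inr ⟨hA, kA⟩)) (poch_raise r (m + n) (.inl (by
      positivity))) (commute_poch_left (commute_add_left (commute_poch_right h _) _) _)) _)
      (poch_inv_raise r (k := m))).trans (by
      simp only [H1, mul_assoc])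
  · exact fun h₁ h₂ => .of_coeff fun ⟨hA, _⟩ _ m n => (mul_eq_of_right_self (mul_eq_of_left_right
      (mul_eq_of_left (poch_lower hA r (m - n)) (poch_raise r (m + n) (.inl (by positivity)))
      (commute_poch_left (commute_sub_left (commute_poch_right h₁ _) _) _)) (poch_raise_right r n
      (.inl (by positivity)))) (commute_poch_left (commute_inv_right (commute_poch_right h₂ _))
      _)).trans (by
      simp only [H1, neg_one_pow_mul_eq_smul, smul_mul_assoc, mul_assoc])
  · exact .of_coeff (monomialCurve_div y) (fun ⟨hP, _⟩ ⟨kP, _⟩ _ _ => .inr ⟨hP, kP⟩)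
      (fun _ _ => (((ReplaceLeft.self _ _ _).mul_right _).mul_right _).mul_right _)
  · exact fun h => .of_coeff (monomialCurve_mul y) (fun _ _ _ _ => .inl (by positivity))
      (fun _ _ => ((ReplaceLeft.left_mul (commute_poch_right h.symm _) _ _).mul_right _).mul_right
        _)
  · exact fun h => .of_coeff (monomialCurve_snd x) (fun _ _ _ _ => .inl (by positivity))
      (fun _ _ => (ReplaceRight.left_mul _ _ _ _).mul_right (commute_inv_right (commute_poch_right
        h _)))
  · exact .of_coeff (monomialCurve_fst y) (fun ⟨_, hC⟩ ⟨_, kC⟩ => ⟨hC, kC⟩)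
      (fun _ _ => ReplaceRight.left_mul _ _ _ _)
  · exact fun h => .of_coeff fun ⟨hA, _⟩ ⟨kA, _⟩ m n => (mul_eq_of_left_right (mul_eq_of_left_self
      (mul_eq_of_left_self (mul_eq_of_left (poch_raise r (m - n) (.inr ⟨hA, kA⟩)) (poch_raise r m
      (.inl (by positivity))) (commute_poch_left (commute_add_left (commute_poch_right h _) _) _))
      _) _) (poch_inv_raise r (k := m))).trans (by
      simp only [H2, mul_assoc])
  · exact fun h₁ h₂ h₃ => .of_coeff fun ⟨hA, _⟩ _ m n => (mul_eq_of_right_self (mul_eq_of_right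
      (mul_eq_of_left_right (mul_eq_of_left_self (poch_lower hA r (m - n)) _) (poch_raise_right r n
      (.inl (by positivity)))) (poch_raise_right r n (.inl (by positivity))) (commute_poch_left
      (commute_poch_right (commute_add_right h₁ _) _) _)) ((commute_poch_left (commute_inv_right
      (commute_poch_right h₂ _)) _).mul_left (commute_poch_left (commute_inv_right
      (commute_poch_right h₃ _)) _))).trans (by
      simp only [H2, neg_one_pow_mul_eq_smul, smul_mul_assoc, mul_assoc])
  · exact .of_coeff (monomialCurve_div y) (fun ⟨hP, _⟩ ⟨kP, _⟩ _ _ => .inr ⟨hP, kP⟩)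
      (fun _ _ => ((((ReplaceLeft.self _ _ _).mul_right _).mul_right _).mul_right _).mul_right _)
  · exact fun h => .of_coeff (monomialCurve_fst y) (fun _ _ _ _ => .inl (by positivity))
      (fun _ _ => (((ReplaceLeft.left_mul (commute_poch_right h.symm _) _ _).mul_right _).mul_right
        _).mul_right _)
  · exact fun h₁ h₂ => .of_coeff (monomialCurve_snd x) (fun _ _ _ _ => .inl (by positivity))
      (fun _ _ => ((ReplaceRight.left_mul _ _ _ _).mul_right (commute_poch_right h₁ _)).mul_right
        (commute_inv_right (commute_poch_right h₂ _)))
  · exact .of_coeff (monomialCurve_fst y) (fun ⟨_, hC⟩ ⟨_, kC⟩ => ⟨hC, kC⟩)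
      (fun _ _ => ReplaceRight.left_mul _ _ _ _)
  · exact .of_coeff fun _ _ m n => (mul_eq_of_left_right (mul_eq_of_left_self (poch_raise_two r (2
      * m + n) (.inl (by positivity))) _) (poch_inv_raise r (k := m + n))).trans (by
      simp only [H3, mul_assoc])
  · exact fun h => .of_coeff fun _ _ m n => (mul_eq_of_right (mul_eq_of_left_right (poch_raise r (2
      * m + n) (.inl (by positivity))) (poch_raise_right r n (.inl (by positivity))))
      (poch_inv_raise r (k := m + n)) (commute_poch_left (commute_inv_right (commute_poch_right
      (commute_add_right h _) _)) _)).trans (by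
      simp only [H3, mul_assoc])
  · exact .of_coeff (monomialCurve_sq_mul y) (fun _ _ _ _ => .inl (by positivity))
      (fun _ _ => ((ReplaceLeft.self _ _ _).mul_right _).mul_right _)
  · exact fun h => .of_coeff (monomialCurve_snd x) (fun _ _ _ _ => .inl (by positivity))
      (fun _ _ => (ReplaceRight.left_mul _ _ _ _).mul_right (commute_inv_right (commute_poch_right
        h _)))
  -- Along `(x, x y)` the degree is `m + n`, the index at which `C` occurs.
  · exact .of_coeff (monomialCurve_mul' y) (fun hC kC => ⟨hC, kC⟩)
      (fun _ _ => ReplaceRight.left_mul _ _ _ _)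
  · exact fun h => .of_coeff fun _ _ m n => (mul_eq_of_right_self (mul_eq_of_left_right
      (mul_eq_of_left_self (poch_raise_two r (2 * m + n) (.inl (by positivity))) _) (poch_inv_raise
      r (k := m))) (commute_inv_left (commute_poch_left (commute_inv_right (commute_poch_right h
      _)) _))).trans (by
      simp only [H4, mul_assoc])
  · exact fun h => .of_coeff fun _ _ m n => (mul_eq_of_left_right (mul_eq_of_left_self
      (mul_eq_of_left (poch_raise r (2 * m + n) (.inl (by positivity))) (poch_raise r n (.inl (by
      positivity))) (commute_poch_left (commute_add_left (commute_poch_right h _) _) _)) _)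
      (poch_inv_raise r (k := n))).trans (by
      simp only [H4, mul_assoc])
  · exact .of_coeff (monomialCurve_sq_mul y) (fun _ _ _ _ => .inl (by positivity))
      (fun _ _ => (((ReplaceLeft.self _ _ _).mul_right _).mul_right _).mul_right _)
  · exact fun h => .of_coeff (monomialCurve_snd x) (fun _ _ _ _ => .inl (by positivity))
      (fun _ _ => ((ReplaceLeft.left_mul (commute_poch_right h.symm _) _ _).mul_right _).mul_right
        _)
  · exact fun h => .of_coeff (monomialCurve_fst y) (fun ⟨hC, _⟩ ⟨kC, _⟩ => ⟨hC, kC⟩)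
      (fun _ _ => (ReplaceRight.left_mul _ _ _ _).mul_right (commute_inv_right (commute_poch_right
        h _)))
  · exact .of_coeff (monomialCurve_snd x) (fun ⟨_, hC⟩ ⟨_, kC⟩ => ⟨hC, kC⟩)
      (fun _ _ => ReplaceRight.left_mul _ _ _ _)
  -- Both constants leave on the left, so that of `B` crosses the symbol of `A`; the right constant
  -- is `1`.
  · exact fun h => .of_coeff fun ⟨hB, _⟩ _ m n => (mul_eq_of_left_self (mul_eq_of_left
      (poch_raise_two r (2 * m + n) (.inl (by positivity))) (poch_lower hB r (n - m))
      ((commute_neg_one_pow_right _ _).mul_right (commute_poch_left (commute_add_left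
      (commute_inv_right (commute_poch_right (commute_one_sub_right h) _)) _) _))) _).trans (by
      simp only [H5, neg_one_pow_mul_eq_smul, smul_mul_assoc, mul_smul_comm, mul_assoc, mul_one])
  · exact fun h => .of_coeff fun ⟨hB, _⟩ ⟨kB, _⟩ m n => (mul_eq_of_left_right (mul_eq_of_left
      (poch_raise r (2 * m + n) (.inl (by positivity))) (poch_raise r (n - m) (.inr ⟨hB, kB⟩))
      (commute_poch_left (commute_add_left (commute_poch_right h _) _) _)) (poch_inv_raise r (k :=
      n))).trans (by
      simp only [H5, mul_assoc])
  · exact .of_coeff (monomialCurve_sq_mul y) (fun _ _ _ _ => .inl (by positivity))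
      (fun _ _ => ((ReplaceLeft.self _ _ _).mul_right _).mul_right _)
  · exact fun h => .of_coeff (monomialCurve_div_fst x) (fun ⟨hP, _⟩ ⟨kP, _⟩ _ _ => .inr ⟨hP, kP⟩)
      (fun _ _ => (ReplaceLeft.left_mul (commute_poch_right h.symm _) _ _).mul_right _)
  · exact .of_coeff (monomialCurve_snd x) (fun ⟨_, hC⟩ ⟨_, kC⟩ => ⟨hC, kC⟩)
      (fun _ _ => ReplaceRight.left_mul _ _ _ _)
  · exact fun h => .of_coeff fun ⟨hA, hB⟩ ⟨kA, _⟩ m n => (mul_eq_of_left_self (mul_eq_of_left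
      (poch_raise_two r (2 * m - n) (.inr ⟨hA, kA⟩)) (poch_lower hB r (n - m))
      ((commute_neg_one_pow_right _ _).mul_right (commute_poch_left (commute_add_left
      (commute_inv_right (commute_poch_right (commute_one_sub_right h) _)) _) _))) _).trans (by
      simp only [H6, neg_one_pow_mul_eq_smul, smul_mul_assoc, mul_smul_comm, mul_assoc, mul_one])
  · exact fun h => .of_coeff fun ⟨hA, hB⟩ ⟨_, kB⟩ m n => (mul_eq_of_left_right (mul_eq_of_left
      (poch_lower hA r (2 * m - n)) (poch_raise r (n - m) (.inr ⟨hB, kB⟩)) (commute_poch_left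
      (commute_sub_left (commute_poch_right h _) _) _)) (poch_raise_right r n (.inl (by
      positivity)))).trans (by
      simp only [H6, neg_one_pow_mul_eq_smul, smul_mul_assoc, mul_assoc])
  · exact .of_coeff (monomialCurve_sq_div y) (fun ⟨hP, _⟩ ⟨kP, _⟩ _ _ => .inr ⟨hP, kP⟩)
      (fun _ _ => ((ReplaceLeft.self _ _ _).mul_right _).mul_right _)
  · exact fun h => .of_coeff (monomialCurve_div_fst x) (fun ⟨_, hP⟩ ⟨_, kP⟩ _ _ => .inr ⟨hP, kP⟩)
      (fun _ _ => (ReplaceLeft.left_mul (commute_poch_right h.symm _) _ _).mul_right _)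
  · exact .of_coeff (monomialCurve_snd x) (fun _ _ _ _ => .inl (by positivity))
      (fun _ _ => ReplaceRight.left_mul _ _ _ _)
  · exact .of_coeff fun ⟨hA, _⟩ ⟨kA, _⟩ m n => (mul_eq_of_left_right (mul_eq_of_left_self
      (mul_eq_of_left_self (poch_raise_two r (2 * m - n) (.inr ⟨hA, kA⟩)) _) _) (poch_inv_raise r
      (k := m))).trans (by
      simp only [H7, mul_assoc])
  · exact fun h₁ h₂ => .of_coeff fun ⟨hA, _⟩ _ m n => (mul_eq_of_right_self (mul_eq_of_left_right
      (mul_eq_of_left (poch_lower hA r (2 * m - n)) (poch_raise r n (.inl (by positivity)))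
      (commute_poch_left (commute_sub_left (commute_poch_right h₁ _) _) _)) (poch_raise_right r n
      (.inl (by positivity)))) (commute_poch_left (commute_inv_right (commute_poch_right h₂ _))
      _)).trans (by
      simp only [H7, neg_one_pow_mul_eq_smul, smul_mul_assoc, mul_assoc])
  · exact .of_coeff (monomialCurve_sq_div y) (fun ⟨hP, _⟩ ⟨kP, _⟩ _ _ => .inr ⟨hP, kP⟩)
      (fun _ _ => (((ReplaceLeft.self _ _ _).mul_right _).mul_right _).mul_right _)
  · exact fun h => .of_coeff (monomialCurve_snd x) (fun _ _ _ _ => .inl (by positivity))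
      (fun _ _ => ((ReplaceLeft.left_mul (commute_poch_right h.symm _) _ _).mul_right _).mul_right
        _)
  · exact fun h => .of_coeff (monomialCurve_snd x) (fun _ _ _ _ => .inl (by positivity))
      (fun _ _ => (ReplaceRight.left_mul _ _ _ _).mul_right (commute_inv_right (commute_poch_right
        h _)))
  · exact .of_coeff (monomialCurve_fst y) (fun ⟨_, hC⟩ ⟨_, kC⟩ => ⟨hC, kC⟩)
      (fun _ _ => ReplaceRight.left_mul _ _ _ _)
  · exact fun h => .of_coeff fun ⟨hB, hB'⟩ ⟨_, kB'⟩ m n => (mul_eq_of_right (mul_eq_of_left_right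
      (poch_raise r m (.inl (by positivity))) (poch_lower_right hB r (n - m))) (poch_raise_right r
      (m - n) (.inr ⟨hB', kB'⟩)) ((commute_neg_one_pow_left _ _).mul_left (commute_inv_left
      (commute_poch_left (commute_one_sub_left (commute_poch_right (commute_add_right h _) _))
      _)))).trans (by
      simp only [Γ1, neg_one_pow_mul_eq_smul, smul_mul_assoc, mul_smul_comm, mul_assoc])
  · exact fun h => .of_coeff fun ⟨hB, hB'⟩ ⟨kB, _⟩ m n => (mul_eq_of_right (mul_eq_of_left_right
      ((one_mul _).symm) (poch_raise_right r (n - m) (.inr ⟨hB, kB⟩))) (poch_lower_right hB' r (m -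
      n)) (commute_poch_left (commute_poch_right (commute_sub_right h _) _) _)).trans (by
      simp only [Γ1, neg_one_pow_mul_eq_smul, smul_mul_assoc, mul_smul_comm, mul_assoc, one_mul])
  · exact .of_coeff (monomialCurve_fst y) (fun _ _ _ _ => .inl (by positivity))
      (fun _ _ => ((ReplaceLeft.self _ _ _).mul_right _).mul_right _)
  · exact .of_coeff (monomialCurve_div y) (fun ⟨_, hP⟩ ⟨_, kP⟩ _ _ => .inr ⟨hP, kP⟩)
      (fun _ _ => ReplaceRight.left_mul _ _ _ _)
  · exact fun h => .of_coeff (monomialCurve_div_fst x) (fun ⟨hP, _⟩ ⟨kP, _⟩ _ _ => .inr ⟨hP, kP⟩)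
      (fun _ _ => (ReplaceRight.left_mul _ _ _ _).mul_right (commute_poch_right h _))
  · exact .of_coeff fun ⟨hB, hB'⟩ ⟨_, kB'⟩ m n => (mul_eq_of_left_right (poch_lower hB r (n - m))
      (poch_raise_right r (m - n) (.inr ⟨hB', kB'⟩))).trans (by
      simp only [Γ2, neg_one_pow_mul_eq_smul, smul_mul_assoc, mul_assoc])
  · exact .of_coeff fun ⟨hB, hB'⟩ ⟨kB, _⟩ m n => (mul_eq_of_left_right (poch_raise r (n - m) (.inr
      ⟨hB, kB⟩)) (poch_lower_right hB' r (m - n))).trans (by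
      simp only [Γ2, neg_one_pow_mul_eq_smul, smul_mul_assoc, mul_smul_comm, mul_assoc])
  · exact .of_coeff (monomialCurve_div y) (fun ⟨_, hP⟩ ⟨_, kP⟩ _ _ => .inr ⟨hP, kP⟩)
      (fun _ _ => ReplaceRight.left_mul _ _ _ _)
  -- The symbol of `B` is the first factor, so the left form needs no commutation. In the right
  -- form, proved next, the multiplier must cross the symbol of `B'`.
  · exact .of_coeff (monomialCurve_div_fst x) (fun ⟨hP, _⟩ ⟨kP, _⟩ _ _ => .inr ⟨hP, kP⟩)
      (fun _ _ => (ReplaceLeft.self _ _ _).mul_right _)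
  · exact fun h => .of_coeff (monomialCurve_div_fst x) (fun ⟨hP, _⟩ ⟨kP, _⟩ _ _ => .inr ⟨hP, kP⟩)
      (fun _ _ => (ReplaceRight.self _ _ _).mul_right (commute_poch_right h _))
  · exact fun h => .of_coeff fun ⟨hA, _⟩ ⟨kA, _⟩ m n => (mul_eq_of_left_right (mul_eq_of_left
      (poch_raise r (m - n) (.inr ⟨hA, kA⟩)) (poch_raise r (m + n) (.inl (by positivity)))
      (commute_poch_left (commute_add_left (commute_poch_right h _) _) _)) (poch_inv_raise r (k :=
      m))).trans (by
      simp only [ℋ1, mul_assoc])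
  · exact fun h => .of_coeff fun ⟨hA, _⟩ _ m n => (mul_eq_of_left_self (mul_eq_of_left (poch_lower
      hA r (m - n)) (poch_raise r (m + n) (.inl (by positivity))) (commute_poch_left
      (commute_sub_left (commute_poch_right h _) _) _)) _).trans (by
      simp only [ℋ1, neg_one_pow_mul_eq_smul, smul_mul_assoc, mul_assoc, mul_one])
  · exact .of_coeff (monomialCurve_div y) (fun ⟨hP, _⟩ ⟨kP, _⟩ _ _ => .inr ⟨hP, kP⟩)
      (fun _ _ => ((ReplaceLeft.self _ _ _).mul_right _).mul_right _)
  · exact fun h => .of_coeff (monomialCurve_mul y) (fun _ _ _ _ => .inl (by positivity))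
      (fun _ _ => (ReplaceLeft.left_mul (commute_poch_right h.symm _) _ _).mul_right _)
  · exact .of_coeff (monomialCurve_fst y) (fun ⟨_, hC⟩ ⟨_, kC⟩ => ⟨hC, kC⟩)
      (fun _ _ => ReplaceRight.left_mul _ _ _ _)
  · exact fun h => .of_coeff fun ⟨hA, _⟩ ⟨kA, _⟩ m n => (mul_eq_of_left_right (mul_eq_of_left_self
      (mul_eq_of_left (poch_raise r (m - n) (.inr ⟨hA, kA⟩)) (poch_raise r m (.inl (by
      positivity))) (commute_poch_left (commute_add_left (commute_poch_right h _) _) _)) _)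
      (poch_inv_raise r (k := m))).trans (by
      simp only [ℋ2, mul_assoc])
  · exact fun h => .of_coeff fun ⟨hA, _⟩ _ m n => (mul_eq_of_right_self (mul_eq_of_left_right
      (mul_eq_of_left_self (poch_lower hA r (m - n)) _) (poch_raise_right r n (.inl (by
      positivity)))) (commute_poch_left (commute_inv_right (commute_poch_right h _)) _)).trans (by
      simp only [ℋ2, neg_one_pow_mul_eq_smul, smul_mul_assoc, mul_assoc])
  · exact .of_coeff (monomialCurve_div y) (fun ⟨hP, _⟩ ⟨kP, _⟩ _ _ => .inr ⟨hP, kP⟩)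
      (fun _ _ => (((ReplaceLeft.self _ _ _).mul_right _).mul_right _).mul_right _)
  · exact fun h => .of_coeff (monomialCurve_fst y) (fun _ _ _ _ => .inl (by positivity))
      (fun _ _ => ((ReplaceLeft.left_mul (commute_poch_right h.symm _) _ _).mul_right _).mul_right
        _)
  · exact fun h => .of_coeff (monomialCurve_snd x) (fun _ _ _ _ => .inl (by positivity))
      (fun _ _ => (ReplaceRight.left_mul _ _ _ _).mul_right (commute_inv_right (commute_poch_right
        h _)))
  · exact .of_coeff (monomialCurve_fst y) (fun ⟨_, hC⟩ ⟨_, kC⟩ => ⟨hC, kC⟩)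
      (fun _ _ => ReplaceRight.left_mul _ _ _ _)
  · exact fun h => .of_coeff fun ⟨hA, _⟩ ⟨kA, _⟩ m n => (mul_eq_of_right (mul_eq_of_left_right
      (poch_raise r (m - n) (.inr ⟨hA, kA⟩)) (poch_raise_right r m (.inl (by positivity))))
      (poch_inv_raise r (k := m)) (commute_poch_left (commute_inv_right (commute_poch_right
      (commute_add_right h _) _)) _)).trans (by
      simp only [ℋ3, mul_assoc])
  · exact .of_coeff fun ⟨hA, _⟩ _ m n => (mul_eq_of_left_self (mul_eq_of_left_self (poch_lower hA r
      (m - n)) _) _).trans (by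
      simp only [ℋ3, neg_one_pow_mul_eq_smul, smul_mul_assoc, mul_assoc, mul_one])
  · exact .of_coeff (monomialCurve_div y) (fun ⟨hP, _⟩ ⟨kP, _⟩ _ _ => .inr ⟨hP, kP⟩)
      (fun _ _ => ((ReplaceLeft.self _ _ _).mul_right _).mul_right _)
  · exact fun h => .of_coeff (monomialCurve_fst y) (fun _ _ _ _ => .inl (by positivity))
      (fun _ _ => (ReplaceRight.left_mul _ _ _ _).mul_right (commute_inv_right (commute_poch_right
        h _)))
  · exact .of_coeff (monomialCurve_fst y) (fun ⟨_, hC⟩ ⟨_, kC⟩ => ⟨hC, kC⟩)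
      (fun _ _ => ReplaceRight.left_mul _ _ _ _)
  · exact .of_coeff fun ⟨hA, _⟩ ⟨kA, _⟩ m n => (mul_eq_of_left_right (mul_eq_of_left_self
      (poch_raise r (m - n) (.inr ⟨hA, kA⟩)) _) (poch_inv_raise r (k := m))).trans (by
      simp only [ℋ4, mul_assoc])
  · exact fun h => .of_coeff fun ⟨hA, _⟩ _ m n => (mul_eq_of_right_self (mul_eq_of_left_right
      (poch_lower hA r (m - n)) (poch_raise_right r n (.inl (by positivity)))) (commute_poch_left
      (commute_inv_right (commute_poch_right h _)) _)).trans (by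
      simp only [ℋ4, neg_one_pow_mul_eq_smul, smul_mul_assoc, mul_assoc])
  · exact .of_coeff (monomialCurve_div y) (fun ⟨hP, _⟩ ⟨kP, _⟩ _ _ => .inr ⟨hP, kP⟩)
      (fun _ _ => ((ReplaceLeft.self _ _ _).mul_right _).mul_right _)
  · exact fun h => .of_coeff (monomialCurve_snd x) (fun _ _ _ _ => .inl (by positivity))
      (fun _ _ => (ReplaceRight.left_mul _ _ _ _).mul_right (commute_inv_right (commute_poch_right
        h _)))
  · exact .of_coeff (monomialCurve_fst y) (fun ⟨_, hC⟩ ⟨_, kC⟩ => ⟨hC, kC⟩)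
      (fun _ _ => ReplaceRight.left_mul _ _ _ _)
  · exact .of_coeff fun ⟨hA, _⟩ ⟨kA, _⟩ m n => (mul_eq_of_left_right (poch_raise r (m - n) (.inr
      ⟨hA, kA⟩)) (poch_inv_raise r (k := m))).trans (by
      simp only [ℋ5, mul_assoc])
  · exact .of_coeff fun ⟨hA, _⟩ _ m n => (mul_eq_of_left_self (poch_lower hA r (m - n)) _).trans (by
      simp only [ℋ5, neg_one_pow_mul_eq_smul, smul_mul_assoc, mul_one])
  · exact .of_coeff (monomialCurve_div y) (fun ⟨hP, _⟩ ⟨kP, _⟩ _ _ => .inr ⟨hP, kP⟩)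
      (fun _ _ => (ReplaceLeft.self _ _ _).mul_right _)
  · exact .of_coeff (monomialCurve_fst y) (fun ⟨_, hC⟩ ⟨_, kC⟩ => ⟨hC, kC⟩)
      (fun _ _ => ReplaceRight.left_mul _ _ _ _)
  · exact .of_coeff fun _ _ m n => (mul_eq_of_left_right (poch_raise_two r (2 * m + n) (.inl (by
      positivity))) (poch_inv_raise r (k := m + n))).trans (by
      simp only [ℋ6, mul_assoc])
  · exact .of_coeff fun _ _ m n => (mul_eq_of_left_right (poch_raise r (2 * m + n) (.inl (by
      positivity))) (poch_inv_raise r (k := m + n))).trans (by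
      simp only [ℋ6, mul_assoc])
  · exact .of_coeff (monomialCurve_sq_mul y) (fun _ _ _ _ => .inl (by positivity))
      (fun _ _ => (ReplaceLeft.self _ _ _).mul_right _)
  · exact .of_coeff (monomialCurve_mul' y) (fun hC kC => ⟨hC, kC⟩)
      (fun _ _ => ReplaceRight.left_mul _ _ _ _)
  -- The constant `(C)_r⁻¹` must cross `(C')_n⁻¹`, the last factor; hence the hypothesis on `C` and
  -- `C'`.
  · exact fun h => .of_coeff fun _ _ m n => (mul_eq_of_right_self (mul_eq_of_left_right
      (poch_raise_two r (2 * m + n) (.inl (by positivity))) (poch_inv_raise r (k := m)))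
      (commute_inv_left (commute_poch_left (commute_inv_right (commute_poch_right h _)) _))).trans
      (by
      simp only [ℋ7, mul_assoc])
  · exact .of_coeff fun _ _ m n => (mul_eq_of_left_right (mul_eq_of_left_self (poch_raise r (2 * m
      + n) (.inl (by positivity))) _) (poch_inv_raise r (k := n))).trans (by
      simp only [ℋ7, mul_assoc])
  · exact .of_coeff (monomialCurve_sq_mul y) (fun _ _ _ _ => .inl (by positivity))
      (fun _ _ => ((ReplaceLeft.self _ _ _).mul_right _).mul_right _)
  · exact fun h => .of_coeff (monomialCurve_fst y) (fun ⟨hC, _⟩ ⟨kC, _⟩ => ⟨hC, kC⟩)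
      (fun _ _ => (ReplaceRight.left_mul _ _ _ _).mul_right (commute_inv_right (commute_poch_right
        h _)))
  · exact .of_coeff (monomialCurve_snd x) (fun ⟨_, hC⟩ ⟨_, kC⟩ => ⟨hC, kC⟩)
      (fun _ _ => ReplaceRight.left_mul _ _ _ _)
  · exact .of_coeff fun ⟨hA, hB⟩ ⟨kA, _⟩ m n => (mul_eq_of_left_right (poch_raise_two r (2 * m - n)
      (.inr ⟨hA, kA⟩)) (poch_lower_right hB r (n - m))).trans (by
      simp only [ℋ8, neg_one_pow_mul_eq_smul, smul_mul_assoc, mul_smul_comm, mul_assoc])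
  · exact .of_coeff fun ⟨hA, hB⟩ ⟨_, kB⟩ m n => (mul_eq_of_left_right (poch_lower hA r (2 * m - n))
      (poch_raise_right r (n - m) (.inr ⟨hB, kB⟩))).trans (by
      simp only [ℋ8, neg_one_pow_mul_eq_smul, smul_mul_assoc, mul_assoc])
  · exact .of_coeff (monomialCurve_sq_div y) (fun ⟨hP, _⟩ ⟨kP, _⟩ _ _ => .inr ⟨hP, kP⟩)
      (fun _ _ => (ReplaceLeft.self _ _ _).mul_right _)
  · exact .of_coeff (monomialCurve_div_fst x) (fun ⟨_, hP⟩ ⟨_, kP⟩ _ _ => .inr ⟨hP, kP⟩)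
      (fun _ _ => ReplaceRight.left_mul _ _ _ _)
  · exact .of_coeff fun ⟨hA, _⟩ ⟨kA, _⟩ m n => (mul_eq_of_left_right (mul_eq_of_left_self
      (poch_raise_two r (2 * m - n) (.inr ⟨hA, kA⟩)) _) (poch_inv_raise r (k := m))).trans (by
      simp only [ℋ9, mul_assoc])
  · exact fun h => .of_coeff fun ⟨hA, _⟩ _ m n => (mul_eq_of_right_self (mul_eq_of_left_right
      (poch_lower hA r (2 * m - n)) (poch_raise_right r n (.inl (by positivity))))
      (commute_poch_left (commute_inv_right (commute_poch_right h _)) _)).trans (by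
      simp only [ℋ9, neg_one_pow_mul_eq_smul, smul_mul_assoc, mul_assoc])
  · exact .of_coeff (monomialCurve_sq_div y) (fun ⟨hP, _⟩ ⟨kP, _⟩ _ _ => .inr ⟨hP, kP⟩)
      (fun _ _ => ((ReplaceLeft.self _ _ _).mul_right _).mul_right _)
  · exact fun h => .of_coeff (monomialCurve_snd x) (fun _ _ _ _ => .inl (by positivity))
      (fun _ _ => (ReplaceRight.left_mul _ _ _ _).mul_right (commute_inv_right (commute_poch_right
        h _)))
  · exact .of_coeff (monomialCurve_fst y) (fun ⟨_, hC⟩ ⟨_, kC⟩ => ⟨hC, kC⟩)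
      (fun _ _ => ReplaceRight.left_mul _ _ _ _)
  · exact .of_coeff fun ⟨hA, _⟩ ⟨kA, _⟩ m n => (mul_eq_of_left_right (poch_raise_two r (2 * m - n)
      (.inr ⟨hA, kA⟩)) (poch_inv_raise r (k := m))).trans (by
      simp only [ℋ10, mul_assoc])
  · exact .of_coeff fun ⟨hA, _⟩ _ m n => (mul_eq_of_left_self (poch_lower hA r (2 * m - n))
      _).trans (by
      simp only [ℋ10, neg_one_pow_mul_eq_smul, smul_mul_assoc, mul_one])
  · exact .of_coeff (monomialCurve_sq_div y) (fun ⟨hP, _⟩ ⟨kP, _⟩ _ _ => .inr ⟨hP, kP⟩)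
      (fun _ _ => (ReplaceLeft.self _ _ _).mul_right _)
  · exact .of_coeff (monomialCurve_fst y) (fun ⟨_, hC⟩ ⟨_, kC⟩ => ⟨hC, kC⟩)
      (fun _ _ => ReplaceRight.left_mul _ _ _ _)
  · exact .of_coeff fun ⟨hA, _⟩ ⟨kA, _⟩ m n => (mul_eq_of_left_right (mul_eq_of_left_self
      (mul_eq_of_left_self (poch_raise r (m - n) (.inr ⟨hA, kA⟩)) _) _) (poch_inv_raise r (k :=
      m))).trans (by
      simp only [ℋ11, mul_assoc])
  · exact fun h₁ h₂ => .of_coeff fun ⟨hA, _⟩ _ m n => (mul_eq_of_right_self (mul_eq_of_left_right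
      (mul_eq_of_left (poch_lower hA r (m - n)) (poch_raise r n (.inl (by positivity)))
      (commute_poch_left (commute_sub_left (commute_poch_right h₁ _) _) _)) (poch_raise_right r n
      (.inl (by positivity)))) (commute_poch_left (commute_inv_right (commute_poch_right h₂ _))
      _)).trans (by
      simp only [ℋ11, neg_one_pow_mul_eq_smul, smul_mul_assoc, mul_assoc])
  · exact .of_coeff (monomialCurve_div y) (fun ⟨hP, _⟩ ⟨kP, _⟩ _ _ => .inr ⟨hP, kP⟩)
      (fun _ _ => (((ReplaceLeft.self _ _ _).mul_right _).mul_right _).mul_right _)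
  · exact fun h => .of_coeff (monomialCurve_snd x) (fun _ _ _ _ => .inl (by positivity))
      (fun _ _ => ((ReplaceLeft.left_mul (commute_poch_right h.symm _) _ _).mul_right _).mul_right
        _)
  · exact .of_coeff (monomialCurve_fst y) (fun ⟨_, hC⟩ ⟨_, kC⟩ => ⟨hC, kC⟩)
      (fun _ _ => ReplaceRight.left_mul _ _ _ _)
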